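/- For a field $K$ and a finite directed graph $E=(E^0,E^1,s,r)$, let $L_K(E)$ denote the Leavitt path algebra of $E$ over $K$: the (associative) $K$-algebra generated by symbols $w$ ($w\in E^0$) and $e,e^*$ ($e\in E^1$) subject to the relations $ww'=\delta_{w,w'}w$ for $w,w'\in E^0$; $s(e)e=er(e)=e$ and $r(e)e^*=e^*s(e)=e^*$ for $e\in E^1$; $e^*f=\delta_{e,f}\,r(e)$ for $e,f\in E^1$; and $w=\sum_{s(e)=w}ee^*$ for every $w\in E^0$ that is the source of at least one edge. It is unital with $1=\sum_{w\in E^0}w$. Let $[L_K(E),L_K(E)]$ be the $K$-subspace of $L_K(E)$ spanned by all commutators $[x,y]=xy-yx$, viewed as a Lie $K$-algebra under the commutator bracket. A Lie $K$-algebra $L$ is called simple if $[L,L]\neq 0$ and its only Lie ideals are $0$ and $L$. Let $p$ be a prime and let $u,v\ge 2$ be integers. Let $E=E_{u,v,p}$ be the directed graph with exactly two vertices $v_1,v_2$ and exactly the following edges: $puv+1$ loops at $v_1$, $u$ edges from $v_1$ to $v_2$, $pu$ edges from $v_2$ to $v_1$, and $1+u$ loops at $v_2$. Then for every field $K$ the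 algebra $L_K(E)$ is simple, and if $\operatorname{char}(K)=p$, then the Lie $K$-algebra $[L_K(E),L_K(E)]$ is simple. -/

import Mathlib

universe w w₁ w₂ w₃

/-- A directed graph with vertex set `V` and edge set `E`; loops and parallel edges are allowed. -/
structure DirectedGraph (V : Type w₁) (E : Type w₂) where
  /-- the source of an edge -/
  s : E → V
  /-- the range of an edge -/
  r : E → V

namespace DirectedGraph

/-- A vertex is regular if it emits at least one and only finitely many edges. -/
def IsRegular {V : Type w₁} {E : Type w₂} (G : DirectedGraph V E) (v : V) : Prop :=
  {e | G.s e = v}.Finite ∧ {e | G.s e = v}.Nonempty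

end DirectedGraph

namespace Leavitt

/-- The generators `v`, `e`, `e*` of a Leavitt path algebra. -/
inductive Gen (V : Type w₁) (E : Type w₂) : Type (max w₁ w₂)
  | vertex (v : V)
  | edge (e : E)
  | ghost (e : E)

variable (K : Type w) [Field K] {V : Type w₁} {E : Type w₂}

/-- The family `P v`, `S e`, `T e` of elements of a (possibly non-unital) ring satisfies the
relations (V), (E1), (E2), (CK1) and (CK2) imposed on `v`, `e`, `e*`. -/
structure IsFamily (G : DirectedGraph V E) {B : Type w₃} [NonUnitalRing B]
    (P : V → B) (S T : E → B) : Prop where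
  vertex_mul_self : ∀ v, P v * P v = P v
  vertex_mul_of_ne : ∀ v w, v ≠ w → P v * P w = 0
  source_mul_edge : ∀ e, P (G.s e) * S e = S e
  edge_mul_range : ∀ e, S e * P (G.r e) = S e
  range_mul_ghost : ∀ e, P (G.r e) * T e = T e
  ghost_mul_source : ∀ e, T e * P (G.s e) = T e
  ghost_mul_edge_self : ∀ e, T e * S e = P (G.r e)
  ghost_mul_edge_of_ne : ∀ e f, e ≠ f → T e * S f = 0
  vertex_eq_sum : ∀ v, ∀ h : G.IsRegular v, P v = ∑ e ∈ h.1.toFinset, S e * T e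

/-- A generator, seen in the free unital `K`-algebra. -/
def gen (x : Gen V E) : FreeAlgebra K (Gen V E) := FreeAlgebra.ι K x

/-- The defining relations of the Leavitt path algebra of a graph with finitely many vertices.
The relations (V), (E1), (E2) make the sum of all vertices an identity element of the algebra that
they present, and `sum_vertex` says that this is the `1` of the unital algebra constructed here;
see `LeavittPathAlgebra.existsUnique_lift`. -/
inductive Rel [Fintype V] (G : DirectedGraph V E) :
    FreeAlgebra K (Gen V E) → FreeAlgebra K (Gen V E) → Prop
  | vertex_mul_self (v : V) : Rel G (gen K (.vertex v) * gen K (.vertex v)) (gen K (.vertex v))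
  | vertex_mul_of_ne (v w : V) (h : v ≠ w) : Rel G (gen K (.vertex v) * gen K (.vertex w)) 0
  | source_mul_edge (e : E) : Rel G (gen K (.vertex (G.s e)) * gen K (.edge e)) (gen K (.edge e))
  | edge_mul_range (e : E) : Rel G (gen K (.edge e) * gen K (.vertex (G.r e))) (gen K (.edge e))
  | range_mul_ghost (e : E) :
      Rel G (gen K (.vertex (G.r e)) * gen K (.ghost e)) (gen K (.ghost e))
  | ghost_mul_source (e : E) :
      Rel G (gen K (.ghost e) * gen K (.vertex (G.s e))) (gen K (.ghost e))
  | ghost_mul_edge_self (e : E) :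
      Rel G (gen K (.ghost e) * gen K (.edge e)) (gen K (.vertex (G.r e)))
  | ghost_mul_edge_of_ne (e f : E) (h : e ≠ f) : Rel G (gen K (.ghost e) * gen K (.edge f)) 0
  | vertex_eq_sum (v : V) (h : G.IsRegular v) :
      Rel G (gen K (.vertex v)) (∑ e ∈ h.1.toFinset, gen K (.edge e) * gen K (.ghost e))
  | sum_vertex : Rel G (∑ v, gen K (.vertex v)) 1

end Leavitt

/-- The Leavitt path algebra `L_K(G)` of a graph `G` with finitely many vertices. -/
abbrev LeavittPathAlgebra (K : Type w) [Field K] {V : Type w₁} {E : Type w₂} [Fintype V]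
    (G : DirectedGraph V E) : Type (max w w₁ w₂) :=
  RingQuot (Leavitt.Rel K G)

namespace LeavittPathAlgebra

open Leavitt

variable (K : Type w) [Field K] {V : Type w₁} {E : Type w₂} [Fintype V] (G : DirectedGraph V E)

/-- The commutator bracket `[x, y] = x * y - y * x` on `L_K(G)`. -/
instance instLieRing : LieRing (LeavittPathAlgebra K G) := LieRing.ofAssociativeRing

instance instLieAlgebra : LieAlgebra K (LeavittPathAlgebra K G) :=
  LieAlgebra.ofAssociativeAlgebra

/-- The `K`-subspace `[L_K(G), L_K(G)]` of `L_K(G)` spanned by all commutators, as a Lie ideal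
(and hence a Lie `K`-algebra). -/
abbrev commutators : LieIdeal K (LeavittPathAlgebra K G) :=
  LieAlgebra.derivedSeries K (LeavittPathAlgebra K G) 1

theorem commutators_eq_span :
    ((commutators K G : LieIdeal K (LeavittPathAlgebra K G)) :
      Submodule K (LeavittPathAlgebra K G)) =
      Submodule.span K {z | ∃ x y : LeavittPathAlgebra K G, x * y - y * x = z} :=
  LieAlgebra.coe_derivedSeries_one_eq K (LeavittPathAlgebra K G)

/-- The image of a generator in `L_K(G)`. -/
def of (x : Gen V E) : LeavittPathAlgebra K G :=
  RingQuot.mkAlgHom K (Rel K G) (gen K x)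

theorem isFamily : IsFamily G (fun v => of K G (.vertex v)) (fun e => of K G (.edge e))
    (fun e => of K G (.ghost e)) where
  vertex_mul_self v := by
    simpa [of] using RingQuot.mkAlgHom_rel K (Rel.vertex_mul_self (K := K) (G := G) v)
  vertex_mul_of_ne v w h := by
    simpa [of] using RingQuot.mkAlgHom_rel K (Rel.vertex_mul_of_ne (K := K) (G := G) v w h)
  source_mul_edge e := by
    simpa [of] using RingQuot.mkAlgHom_rel K (Rel.source_mul_edge (K := K) (G := G) e)
  edge_mul_range e := by
    simpa [of] using RingQuot.mkAlgHom_rel K (Rel.edge_mul_range (K := K) (G := G) e)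
  range_mul_ghost e := by
    simpa [of] using RingQuot.mkAlgHom_rel K (Rel.range_mul_ghost (K := K) (G := G) e)
  ghost_mul_source e := by
    simpa [of] using RingQuot.mkAlgHom_rel K (Rel.ghost_mul_source (K := K) (G := G) e)
  ghost_mul_edge_self e := by
    simpa [of] using RingQuot.mkAlgHom_rel K (Rel.ghost_mul_edge_self (K := K) (G := G) e)
  ghost_mul_edge_of_ne e f h := by
    simpa [of] using RingQuot.mkAlgHom_rel K (Rel.ghost_mul_edge_of_ne (K := K) (G := G) e f h)
  vertex_eq_sum v h := by
    simpa [of] using RingQuot.mkAlgHom_rel K (Rel.vertex_eq_sum (K := K) (G := G) v h)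

theorem sum_vertex : ∑ v, of K G (.vertex v) = 1 := by
  simpa [of] using RingQuot.mkAlgHom_rel K (Rel.sum_vertex (K := K) (G := G))

/-- The elements fixed by an idempotent `c` on both sides, as a non-unital subalgebra. -/
def corner {B : Type w₃} [NonUnitalRing B] [Module K B] [IsScalarTower K B B]
    [SMulCommClass K B B] (c : B) : NonUnitalSubalgebra K B where
  carrier := {x | c * x = x ∧ x * c = x}
  add_mem' := by
    rintro a b ⟨ha, ha'⟩ ⟨hb, hb'⟩
    exact ⟨by rw [mul_add, ha, hb], by rw [add_mul, ha', hb']⟩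
  zero_mem' := by simp
  mul_mem' := by
    rintro a b ⟨ha, ha'⟩ ⟨hb, hb'⟩
    exact ⟨by rw [← mul_assoc, ha], by rw [mul_assoc, hb']⟩
  smul_mem' := by
    rintro k a ⟨ha, ha'⟩
    exact ⟨by rw [mul_smul_comm, ha], by rw [smul_mul_assoc, ha']⟩

/-- `L_K(G)` is the universal `K`-algebra, unital or not, generated by elements `v`, `e`, `e*`
subject to (V), (E1), (E2), (CK1) and (CK2). -/
theorem existsUnique_lift {B : Type w₃} [NonUnitalRing B] [Module K B] [IsScalarTower K B B]
    [SMulCommClass K B B] {P : V → B} {S T : E → B} (hF : IsFamily G P S T) :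
    ∃! f : LeavittPathAlgebra K G →ₙₐ[K] B,
      (∀ v, f (of K G (.vertex v)) = P v) ∧ (∀ e, f (of K G (.edge e)) = S e) ∧
        (∀ e, f (of K G (.ghost e)) = T e) := by
  classical
  let c : B := ∑ v, P v
  have hcP : ∀ v, c * P v = P v := fun v => by
    simp only [c, Finset.sum_mul]
    rw [Finset.sum_eq_single v (fun w _ h => hF.vertex_mul_of_ne w v h) (by simp),
      hF.vertex_mul_self]
  have hPc : ∀ v, P v * c = P v := fun v => by
    simp only [c, Finset.mul_sum]
    rw [Finset.sum_eq_single v (fun w _ h => hF.vertex_mul_of_ne v w h.symm) (by simp),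
      hF.vertex_mul_self]
  have hcS : ∀ e, c * S e = S e := fun e => by
    rw [← hF.source_mul_edge, ← mul_assoc, hcP]
  have hSc : ∀ e, S e * c = S e := fun e => by
    rw [← hF.edge_mul_range, mul_assoc, hPc]
  have hcT : ∀ e, c * T e = T e := fun e => by
    rw [← hF.range_mul_ghost, ← mul_assoc, hcP]
  have hTc : ∀ e, T e * c = T e := fun e => by
    rw [← hF.ghost_mul_source, mul_assoc, hPc]
  have hcc : c * c = c := by
    change c * (∑ v, P v) = ∑ v, P v
    rw [Finset.mul_sum]
    exact Finset.sum_congr rfl fun v _ => hcP v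
  let C := corner K c
  let _ : Ring C :=
    { (inferInstance : NonUnitalRing C) with
      one := ⟨c, hcc, hcc⟩
      one_mul := fun x => Subtype.ext x.2.1
      mul_one := fun x => Subtype.ext x.2.2 }
  let _ : Algebra K C := Algebra.ofModule (fun k x y => smul_mul_assoc k x y)
    (fun k x y => mul_smul_comm k x y)
  let g : Gen V E → C
    | .vertex v => ⟨P v, hcP v, hPc v⟩
    | .edge e => ⟨S e, hcS e, hSc e⟩
    | .ghost e => ⟨T e, hcT e, hTc e⟩
  let ι : C →ₙₐ[K] B :=
    { toFun := Subtype.val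
      map_smul' := fun _ _ => rfl
      map_zero' := rfl
      map_add' := fun _ _ => rfl
      map_mul' := fun _ _ => rfl }
  have hι : Function.Injective ι := Subtype.val_injective
  have hgP : ∀ v, ι (g (.vertex v)) = P v := fun _ => rfl
  have hgS : ∀ e, ι (g (.edge e)) = S e := fun _ => rfl
  have hgT : ∀ e, ι (g (.ghost e)) = T e := fun _ => rfl
  have hrel : ∀ ⦃x y⦄, Rel K G x y → FreeAlgebra.lift K g x = FreeAlgebra.lift K g y := by
    intro x y h
    apply hι
    induction h with
    | vertex_mul_self v => simpa [gen, hgP, hgS, hgT] using hF.vertex_mul_self v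
    | vertex_mul_of_ne v w h => simpa [gen, hgP, hgS, hgT] using hF.vertex_mul_of_ne v w h
    | source_mul_edge e => simpa [gen, hgP, hgS, hgT] using hF.source_mul_edge e
    | edge_mul_range e => simpa [gen, hgP, hgS, hgT] using hF.edge_mul_range e
    | range_mul_ghost e => simpa [gen, hgP, hgS, hgT] using hF.range_mul_ghost e
    | ghost_mul_source e => simpa [gen, hgP, hgS, hgT] using hF.ghost_mul_source e
    | ghost_mul_edge_self e => simpa [gen, hgP, hgS, hgT] using hF.ghost_mul_edge_self e
    | ghost_mul_edge_of_ne e f h => simpa [gen, hgP, hgS, hgT] using hF.ghost_mul_edge_of_ne e f h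
    | vertex_eq_sum v h => simpa [gen, hgP, hgS, hgT] using hF.vertex_eq_sum v h
    | sum_vertex => simp only [gen, map_sum, FreeAlgebra.lift_ι_apply, map_one]; rfl
  let F : LeavittPathAlgebra K G →ₐ[K] C := RingQuot.liftAlgHom K ⟨FreeAlgebra.lift K g, hrel⟩
  have hFof : ∀ x, F (of K G x) = g x := fun x => by simp [F, of, gen]
  refine ⟨ι.comp (F : LeavittPathAlgebra K G →ₙₐ[K] C), ⟨fun v => ?_, fun e => ?_, fun e => ?_⟩, ?_⟩
  · exact congrArg ι (hFof (.vertex v))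
  · exact congrArg ι (hFof (.edge e))
  · exact congrArg ι (hFof (.ghost e))
  · suffices huniq : ∀ f₁ f₂ : LeavittPathAlgebra K G →ₙₐ[K] B,
        (∀ x, f₁ (of K G x) = f₂ (of K G x)) → f₁ = f₂ by
      rintro f ⟨h₁, h₂, h₃⟩
      apply huniq
      rintro (v | e | e)
      · exact (h₁ v).trans (congrArg ι (hFof (.vertex v))).symm
      · exact (h₂ e).trans (congrArg ι (hFof (.edge e))).symm
      · exact (h₃ e).trans (congrArg ι (hFof (.ghost e))).symm
    intro f₁ f₂ h
    ext z
    obtain ⟨z, rfl⟩ := RingQuot.mkAlgHom_surjective K (Rel K G) z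
    induction z using FreeAlgebra.induction with
    | grade0 k =>
      rw [AlgHom.commutes, Algebra.algebraMap_eq_smul_one, map_smul, map_smul, ← sum_vertex,
        map_sum, map_sum]
      simp only [h]
    | grade1 x => exact h x
    | mul a b ha hb => rw [map_mul, map_mul, map_mul, ha, hb]
    | add a b ha hb => rw [map_add, map_add, map_add, ha, hb]

end LeavittPathAlgebra

/-- The graph with two vertices `v₁ = 0` and `v₂ = 1`, and with `p * u * v + 1` loops at `v₁`,
`u` edges from `v₁` to `v₂`, `p * u` edges from `v₂` to `v₁` and `1 + u` loops at `v₂`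
(the four summands of the edge set, in this order). -/
def twoVertexGraph (u v p : ℕ) :
    DirectedGraph (Fin 2) (Fin (p * u * v + 1) ⊕ Fin u ⊕ Fin (p * u) ⊕ Fin (1 + u)) where
  s := Sum.elim (fun _ => 0) (Sum.elim (fun _ => 0) (Sum.elim (fun _ => 1) (fun _ => 1)))
  r := Sum.elim (fun _ => 0) (Sum.elim (fun _ => 1) (Sum.elim (fun _ => 0) (fun _ => 1)))

/-! Write `L` for the Leavitt path algebra. The Lie statement rests on three facts: `L` is a simple
ring, it has at least four nonzero orthogonal idempotents with sum `1`, and `1 ∉ [L, L]`. The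
characteristic enters only through the last one.

In a simple algebra `A` with such idempotents, a subspace stable under brackets with `[A, A]` is
central or contains `[A, A]` (`central_or_commutatorSpan_le`). A nonzero central element of `A` has
a central inverse, and multiplication by a central element preserves `[A, A]`; so if `1 ∉ [A, A]`,
then `[A, A]` contains no nonzero central element and has no proper nonzero Lie ideal. For `L` the
idempotents are the `e e*`, one for each edge.

Simplicity of `L` (`LeavittPathAlgebra.isSimpleRing`) comes from reducing a nonzero element of an
ideal: multiply by edges on the right until no ghost edges remain, by ghost edges on the left until
a vertex has a nonzero coefficient, then compress between powers of a loop so that only that vertex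
survives. That `L ≠ 0` needs a representation, built on functions on `V × ℕ`.

For `1 ∉ [L, L]` one wants a trace `t` with `t(1) = 1`. On vertices, (CK2) forces `t(v) = ∑ t(r(e))`
over the edges `e` leaving `v`. The indicator of a vertex `o` solves this if the number of edges
from `v` to `o` is `1` or `0` in `K` according as `v = o` or not; for `o = v₁` these numbers are `p
u v + 1` and `p u`. The trace is realised by letting the generators act on functions on paths ending
at `o` and summing diagonal entries over the paths of length `n`. The action violates (CK2) only
where there is no first edge, and the sums are constant for large `n`, so their eventual value
depends only on the element of `L` and vanishes on commutators (`one_notMem_commutatorSpan`). -/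

/-- The `K`-subspace of an algebra spanned by all commutators. -/
def commutatorSpan (K A : Type*) [Field K] [Ring A] [Algebra K A] : Submodule K A :=
  Submodule.span K {z | ∃ x y : A, x * y - y * x = z}

/-! ### Lie ideals of `[A, A]` for a simple algebra `A` with orthogonal idempotents. -/

namespace IsSimpleRing

variable {K A : Type*} [Field K] [Ring A] [Algebra K A] [IsSimpleRing A]

/-- A subspace that contains all `a * z * b`, for some `z ≠ 0`, is everything. -/
theorem mem_of_forall_mul_mul_mem (W : Submodule K A) {z : A} (hz : z ≠ 0)
    (h : ∀ a b, a * z * b ∈ W) (x : A) : x ∈ W := by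
  let I : TwoSidedIdeal A := TwoSidedIdeal.mk' {y | ∀ a b, a * y * b ∈ W} (by simp)
    (fun hx hy a b => by rw [mul_add, add_mul]; exact W.add_mem (hx a b) (hy a b))
    (fun hx a b => by rw [mul_neg, neg_mul]; exact W.neg_mem (hx a b))
    (fun {y z} hz a b => by rw [← mul_assoc]; exact hz (a * y) b)
    (fun {y z} hy a b => by rw [← mul_assoc, mul_assoc]; exact hy a (z * b))
  have h1 : (1 : A) ∈ I := IsSimpleRing.one_mem_of_ne_zero_mem I hz
    ((TwoSidedIdeal.mem_mk' _ _ _ _ _ _ _).2 h)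
  simpa using (TwoSidedIdeal.mem_mk' _ _ _ _ _ _ _).1 h1 x 1

/-- Simple rings are prime: the `x` with `y A x = 0` form a two-sided ideal, which does not contain
`1` because `y ≠ 0`. -/
theorem exists_mul_mul_ne_zero {A : Type*} [Ring A] [IsSimpleRing A] {y z : A} (hy : y ≠ 0)
    (hz : z ≠ 0) : ∃ a, y * a * z ≠ 0 := by
  by_contra! h
  let I : TwoSidedIdeal A := TwoSidedIdeal.mk' {x | ∀ a, y * a * x = 0} (by simp)
    (fun hx hx' a => by rw [mul_add, hx a, hx' a, add_zero])
    (fun hx a => by rw [mul_neg, hx a, neg_zero])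
    (fun {x x'} hx a => by rw [← mul_assoc, mul_assoc y a x]; exact hx (a * x))
    (fun {x x'} hx a => by rw [← mul_assoc, hx a, zero_mul])
  have h1 : (1 : A) ∈ I := IsSimpleRing.one_mem_of_ne_zero_mem I hz
    ((TwoSidedIdeal.mem_mk' _ _ _ _ _ _ _).2 h)
  exact hy (by simpa using (TwoSidedIdeal.mem_mk' _ _ _ _ _ _ _).1 h1 1)

end IsSimpleRing

namespace CompleteOrthogonalIdempotents

variable {K A : Type*} [Field K] [Ring A] [Algebra K A] {ι : Type*} [Fintype ι] {e : ι → A}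

theorem mem_of_forall_peirce_mem (he : CompleteOrthogonalIdempotents e) (W : Submodule K A) {x : A}
    (h : ∀ i j, e i * x * e j ∈ W) : x ∈ W := by
  have hx : x = ∑ i, ∑ j, e i * x * e j := by
    simp_rw [← Finset.mul_sum, ← Finset.sum_mul, he.complete, one_mul, mul_one]
  rw [hx]
  exact W.sum_mem fun i _ => W.sum_mem fun j _ => h i j

/-- The element equals its own bracket with `e i`. -/
theorem offDiag_mem_commutatorSpan (he : CompleteOrthogonalIdempotents e) {i j : ι} (hij : i ≠ j)
    (x : A) : e i * x * e j ∈ commutatorSpan K A := by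
  refine Submodule.subset_span ⟨e i, e i * x * e j, ?_⟩
  rw [mul_assoc (e i * x), he.ortho hij.symm, mul_zero, sub_zero, ← mul_assoc, ← mul_assoc,
    (he.idem i).eq]

variable [IsSimpleRing A]

/-- In a simple ring the off-diagonal Peirce components generate everything. -/
theorem mem_of_mul_mem_of_offDiag_mem (he : CompleteOrthogonalIdempotents e) (hne : ∀ i, e i ≠ 0)
    (hcard : 2 ≤ Fintype.card ι) (T : Submodule K A) (hmul : ∀ x ∈ T, ∀ y ∈ T, x * y ∈ T)
    (hoff : ∀ i j, i ≠ j → ∀ x, e i * x * e j ∈ T) (x : A) : x ∈ T := by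
  refine he.mem_of_forall_peirce_mem T fun i j => ?_
  by_cases hij : i = j
  · subst hij
    have : Nontrivial ι := Fintype.one_lt_card_iff_nontrivial.1 hcard
    obtain ⟨k, hk⟩ := exists_ne i
    let W : Submodule K A := T.comap
      ((LinearMap.mulLeft K (e i)).comp (LinearMap.mulRight K (e i)))
    suffices x ∈ W by simpa [W, mul_assoc] using this
    -- Since `A e_k A = A`, the corner `e_i A e_i` is spanned by products from `e_i A e_k` and `e_k
    -- A e_i`.
    refine IsSimpleRing.mem_of_forall_mul_mul_mem W (hne k) (fun a b => ?_) x
    have := hmul _ (hoff i k hk.symm a) _ (hoff k i hk b)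
    have h2 : e i * a * e k * (e k * b * e i) = e i * (a * e k * b * e i) := by
      rw [← mul_assoc, ← mul_assoc, mul_assoc (e i * a), (he.idem k).eq]
      simp only [mul_assoc]
    rw [h2] at this
    simpa [W] using this
  · exact hoff i j hij x

section

variable (he : CompleteOrthogonalIdempotents e) (hne : ∀ i, e i ≠ 0) {U : Submodule K A}
  (hU : ∀ u ∈ U, ∀ s ∈ commutatorSpan K A, s * u - u * s ∈ U)

include he hne hU

/-- Bracketing `e_k b e_l` with `e_m a e_k` leaves only `e_m a e_k b e_l`, because `e_l e_m = 0`;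
these elements span `e_m A e_l` since `A e_k A = A`. -/
theorem offDiag_mem_left {k l m : ι} (hmk : m ≠ k) (hml : m ≠ l)
    (h : ∀ x, e k * x * e l ∈ U) (x : A) : e m * x * e l ∈ U := by
  let W : Submodule K A := U.comap
      ((LinearMap.mulLeft K (e m)).comp (LinearMap.mulRight K (e l)))
  suffices x ∈ W by simpa [W, mul_assoc] using this
  refine IsSimpleRing.mem_of_forall_mul_mul_mem W (hne k) (fun a b => ?_) x
  have := hU _ (h b) _ (he.offDiag_mem_commutatorSpan hmk a)
  have h2 : e m * a * e k * (e k * b * e l) - e k * b * e l * (e m * a * e k) =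
      e m * a * (e k * e k) * b * e l - e k * b * (e l * e m) * a * e k := by noncomm_ring
  rw [h2, he.ortho hml.symm, (he.idem k).eq] at this
  simpa [W, mul_assoc] using this

theorem offDiag_mem_right {k l m : ι} (hmk : m ≠ k) (hml : m ≠ l)
    (h : ∀ x, e k * x * e l ∈ U) (x : A) : e k * x * e m ∈ U := by
  let W : Submodule K A := U.comap
      ((LinearMap.mulLeft K (e k)).comp (LinearMap.mulRight K (e m)))
  suffices x ∈ W by simpa [W, mul_assoc] using this
  refine IsSimpleRing.mem_of_forall_mul_mul_mem W (hne l) (fun a b => ?_) x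
  have := U.neg_mem (hU _ (h a) _ (he.offDiag_mem_commutatorSpan hml.symm b))
  have h2 : -(e l * b * e m * (e k * a * e l) - e k * a * e l * (e l * b * e m)) =
      e k * a * (e l * e l) * b * e m - e l * b * (e m * e k) * a * e l := by noncomm_ring
  rw [h2, he.ortho hmk, (he.idem l).eq] at this
  simpa [W, mul_assoc] using this

/-- One index is changed at a time, along `(k, l)`, `(c, l)`, `(c, j)`, `(i, j)`; the third index
`c` keeps the route off the diagonal. -/
theorem forall_offDiag_mem (hcard : 3 ≤ Fintype.card ι) {k l : ι} (hkl : k ≠ l)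
    (h : ∀ x, e k * x * e l ∈ U) {i j : ι} (hij : i ≠ j) (x : A) : e i * x * e j ∈ U := by
  classical
  have third : ∀ a b : ι, ∃ c, c ≠ a ∧ c ≠ b := fun a b => by
    obtain ⟨c, hc⟩ := Finset.exists_mem_notMem_of_card_lt_card (s := {a, b})
      (t := Finset.univ) (lt_of_le_of_lt Finset.card_le_two (by rw [Finset.card_univ]; omega))
    exact ⟨c, by simpa [not_or] using hc.2⟩
  have left : ∀ k l m, k ≠ l → m ≠ l → (∀ x, e k * x * e l ∈ U) → ∀ x, e m * x * e l ∈ U := by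
    intro k l m hkl hml h
    by_cases hmk : m = k
    · exact hmk ▸ h
    · exact offDiag_mem_left he hne hU hmk hml h
  have right : ∀ k l m, k ≠ l → m ≠ k → (∀ x, e k * x * e l ∈ U) → ∀ x, e k * x * e m ∈ U := by
    intro k l m hkl hmk h
    by_cases hml : m = l
    · exact hml ▸ h
    · exact offDiag_mem_right he hne hU hmk hml h
  obtain ⟨c, hcl, hcj⟩ := third l j
  have h1 := left k l c hkl hcl h
  have h2 := right c l j hcl hcj.symm h1
  exact left c j i hcj hij h2 x

/-- Brackets with `e_c a e_i` and then `e_j b e_i` turn `e_i z e_j` into `e_c a (e_i z e_j) b e_i`.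
As `e_i z e_j` generates `A` as an ideal, these fill `e_c A e_i`. -/
theorem forall_offDiag_mem_of_ne_zero_mem (hcard : 3 ≤ Fintype.card ι) {i j : ι} (hij : i ≠ j)
    {z : A} (hz : e i * z * e j ∈ U) (hz0 : e i * z * e j ≠ 0) {k l : ι} (hkl : k ≠ l) (x : A) :
    e k * x * e l ∈ U := by
  classical
  obtain ⟨c, -, hc⟩ := Finset.exists_mem_notMem_of_card_lt_card (s := {i, j})
      (t := Finset.univ) (lt_of_le_of_lt Finset.card_le_two (by rw [Finset.card_univ]; omega))
  obtain ⟨hci, hcj⟩ : c ≠ i ∧ c ≠ j := by simpa [not_or] using hc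
  refine forall_offDiag_mem he hne hU hcard hci (fun x => ?_) hkl x
  let W : Submodule K A := U.comap
      ((LinearMap.mulLeft K (e c)).comp (LinearMap.mulRight K (e i)))
  suffices x ∈ W by simpa [W, mul_assoc] using this
  refine IsSimpleRing.mem_of_forall_mul_mul_mem W hz0 (fun a b => ?_) x
  have h1 := hU _ hz _ (he.offDiag_mem_commutatorSpan hci a)
  have h1' : e c * a * e i * (e i * z * e j) - e i * z * e j * (e c * a * e i) =
      e c * a * (e i * e i) * z * e j - e i * z * (e j * e c) * a * e i := by noncomm_ring
  rw [h1', he.ortho hcj.symm, (he.idem i).eq, mul_zero, zero_mul, zero_mul, sub_zero] at h1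
  have h2 := U.neg_mem (hU _ h1 _ (he.offDiag_mem_commutatorSpan hij.symm b))
  have h2' : -(e j * b * e i * (e c * a * e i * z * e j) - e c * a * e i * z * e j *
      (e j * b * e i)) =
      e c * a * e i * z * (e j * e j) * b * e i - e j * b * (e i * e c) * a * e i * z * e j := by
    noncomm_ring
  rw [h2', he.ortho hci.symm, (he.idem j).eq] at h2
  simpa [W, mul_assoc] using h2

/-- A Lie ideal of `[A, A]` that contains a nonzero off-diagonal element is `[A, A]`. -/
theorem commutatorSpan_le_of_ne_zero_mem (hcard : 3 ≤ Fintype.card ι) {i j : ι} (hij : i ≠ j)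
    {z : A} (hz : e i * z * e j ∈ U) (hz0 : e i * z * e j ≠ 0) : commutatorSpan K A ≤ U := by
  have off : ∀ k l, k ≠ l → ∀ x, e k * x * e l ∈ U := fun k l hkl x =>
    forall_offDiag_mem_of_ne_zero_mem he hne hU hcard hij hz hz0 hkl x
  -- `T` consists of the `x` with `[x, A] ⊆ U`. It is closed under products by `[xy, c] = [x, yc] +
  -- [y, cx]`, so it suffices that it contains the off-diagonal components.
  let T : Submodule K A :=
    { carrier := {x | ∀ y, x * y - y * x ∈ U}
      add_mem' := fun {a b} ha hb y => by
        rw [show (a + b) * y - y * (a + b) = (a * y - y * a) + (b * y - y * b) by noncomm_ring]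
        exact U.add_mem (ha y) (hb y)
      zero_mem' := fun y => by simp
      smul_mem' := fun k a ha y => by
        rw [smul_mul_assoc, mul_smul_comm, ← smul_sub]
        exact U.smul_mem k (ha y) }
  have hT : ∀ x, x ∈ T := by
    refine he.mem_of_mul_mem_of_offDiag_mem hne (le_trans (by norm_num) hcard) T ?_ ?_
    · intro x hx y hy c
      rw [show x * y * c - c * (x * y) = (x * (y * c) - y * c * x) + (y * (c * x) - c * x * y) by
        noncomm_ring]
      exact U.add_mem (hx _) (hy _)
    · intro k l hkl x y
      let W : Submodule K A := U.comap
        (LinearMap.mulLeft K (e k * x * e l) - LinearMap.mulRight K (e k * x * e l))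
      have hW : ∀ w, w ∈ W ↔ (e k * x * e l) * w - w * (e k * x * e l) ∈ U := fun _ => Iff.rfl
      rw [← hW]
      refine he.mem_of_forall_peirce_mem W fun a b => ?_
      rw [hW]
      -- An off-diagonal component of `y` is a commutator, so its bracket with an element of `U` is
      -- in `U`. For a diagonal one, both terms of the bracket are off-diagonal or zero.
      by_cases hab : a = b
      · subst hab
        rw [show e k * x * e l * (e a * y * e a) - e a * y * e a * (e k * x * e l) =
          e k * (x * (e l * e a) * y) * e a - e a * (y * (e a * e k) * x) * e l by noncomm_ring]
        refine U.sub_mem ?_ ?_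
        · by_cases hka : k = a
          · subst hka; rw [he.ortho hkl.symm]; simp
          · exact off k a hka _
        · by_cases hal : a = l
          · subst hal; rw [he.ortho hkl.symm]; simp
          · exact off a l hal _
      · have := U.neg_mem (hU _ (off k l hkl x) _ (he.offDiag_mem_commutatorSpan hab y))
        rwa [neg_sub] at this
  refine Submodule.span_le.2 ?_
  rintro _ ⟨x, y, rfl⟩
  exact hT x y

/-- **Herstein's theorem** for a simple algebra with at least four orthogonal idempotents: a Lie
ideal of `[A, A]` is central or all of `[A, A]`, in every characteristic. -/
theorem central_or_commutatorSpan_le (hcard : 4 ≤ Fintype.card ι) :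
    (∀ u ∈ U, ∀ x, x * u = u * x) ∨ commutatorSpan K A ≤ U := by
  classical
  by_cases hle : commutatorSpan K A ≤ U
  · exact Or.inr hle
  refine Or.inl fun u hu => ?_
  have hcard3 : 3 ≤ Fintype.card ι := le_trans (by norm_num) hcard
  have hzero : ∀ i j, i ≠ j → ∀ z, e i * z * e j ∈ U → e i * z * e j = 0 := fun i j hij z hz => by
    by_contra h0
    exact hle (commutatorSpan_le_of_ne_zero_mem he hne hU hcard3 hij hz h0)
  have hdiag : ∀ d a, d ≠ a → e d * u * e a = 0 := by
    intro d a hda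
    by_contra h0
    -- Four idempotents are needed to choose `b` and `c`. Bracketing `u` with `s ∈ e_a A e_b`, `s' ∈
    -- e_c A e_d` and `t ∈ e_a A e_c` collapses to `-t s' u s`, an off-diagonal element of `U`;
    -- primeness provides factors for which it is nonzero.
    obtain ⟨b, -, hb⟩ := Finset.exists_mem_notMem_of_card_lt_card (s := {a, d})
      (t := Finset.univ) (lt_of_le_of_lt Finset.card_le_two (by rw [Finset.card_univ]; omega))
    obtain ⟨hba, hbd⟩ : b ≠ a ∧ b ≠ d := by simpa [not_or] using hb
    obtain ⟨c, -, hc⟩ := Finset.exists_mem_notMem_of_card_lt_card (s := {a, d, b})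
      (t := Finset.univ) (lt_of_le_of_lt Finset.card_le_three (by rw [Finset.card_univ]; omega))
    obtain ⟨hca, hcd, hcb⟩ : c ≠ a ∧ c ≠ d ∧ c ≠ b := by simpa [not_or] using hc
    obtain ⟨x, hx⟩ := IsSimpleRing.exists_mul_mul_ne_zero h0 (hne b)
    obtain ⟨y, hy⟩ := IsSimpleRing.exists_mul_mul_ne_zero (hne c) hx
    obtain ⟨r, hr⟩ := IsSimpleRing.exists_mul_mul_ne_zero (hne a) hy
    have h3 := hU _ (hU _ (hU _ hu _ (he.offDiag_mem_commutatorSpan hba.symm x)) _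
      (he.offDiag_mem_commutatorSpan hcd y)) _ (he.offDiag_mem_commutatorSpan hca.symm r)
    set s := e a * x * e b with hs
    set s' := e c * y * e d with hs'
    set t := e a * r * e c with ht
    have z1 : s' * s = 0 := by
      rw [hs, hs', show e c * y * e d * (e a * x * e b) = e c * y * (e d * e a) * x * e b by
        noncomm_ring, he.ortho hda]; simp
    have z2 : s * s' = 0 := by
      rw [hs, hs', show e a * x * e b * (e c * y * e d) = e a * x * (e b * e c) * y * e d by
        noncomm_ring, he.ortho hcb.symm]; simp
    have z3 : t * s = 0 := by
      rw [hs, ht, show e a * r * e c * (e a * x * e b) = e a * r * (e c * e a) * x * e b by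
        noncomm_ring, he.ortho hca]; simp
    have z4 : s * t = 0 := by
      rw [hs, ht, show e a * x * e b * (e a * r * e c) = e a * x * (e b * e a) * r * e c by
        noncomm_ring, he.ortho hba]; simp
    have z5 : s' * t = 0 := by
      rw [hs', ht, show e c * y * e d * (e a * r * e c) = e c * y * (e d * e a) * r * e c by
        noncomm_ring, he.ortho hda]; simp
    have h4 : t * (s' * (s * u - u * s) - (s * u - u * s) * s') -
        (s' * (s * u - u * s) - (s * u - u * s) * s') * t =
        -(t * s' * u * s) + t * (s' * s) * u - (t * s) * u * s' + t * u * (s * s')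
          - (s' * s) * u * t + s' * u * (s * t) + s * u * (s' * t) - u * (s * s') * t := by
      noncomm_ring
    rw [h4, z1, z2, z3, z4, z5] at h3
    simp only [mul_zero, zero_mul, add_zero, sub_zero] at h3
    have h5 : t * s' * u * s = e a * (r * (e c * e c) * y * e d * u * e a * x) * e b := by
      rw [ht, hs', hs]; noncomm_ring
    have h6 : e a * r * (e c * y * (e d * u * e a * x * e b)) =
        e a * (r * (e c * e c) * y * e d * u * e a * x) * e b := by
      rw [(he.idem c).eq]; noncomm_ring
    rw [h6] at hr
    exact hr (hzero a b hba.symm _ (h5 ▸ (Submodule.neg_mem_iff U).1 h3))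
  have hcomm : ∀ i, e i * u = u * e i := by
    intro i
    have h1 : e i * u = e i * u * e i := by
      conv_lhs => rw [← mul_one (e i * u), ← he.complete, Finset.mul_sum]
      exact Finset.sum_eq_single i (fun j _ hj => hdiag i j hj.symm) (by simp)
    have h2 : u * e i = e i * u * e i := by
      conv_lhs => rw [← one_mul (u * e i), ← he.complete, Finset.sum_mul]
      simp_rw [← mul_assoc]
      exact Finset.sum_eq_single i (fun j _ hj => hdiag j i hj) (by simp)
    rw [h1, h2]
  -- As `u` commutes with every `e_i`, the bracket `[e_i x e_j, u] = e_i [x, u] e_j` is off-diagonal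
  -- and in `U`, hence zero. So the centralizer of `u` contains all off-diagonal components.
  let T : Submodule K A := (Subalgebra.centralizer K {u}).toSubmodule
  have hT : ∀ x, x ∈ T ↔ u * x = x * u := fun x => by
    simp [T, Subalgebra.mem_centralizer_iff]
  intro x
  refine ((hT x).1 (he.mem_of_mul_mem_of_offDiag_mem hne (le_trans (by norm_num) hcard) T
    (fun x hx y hy => Subalgebra.mul_mem _ hx hy) (fun i j hij x => (hT _).2 ?_) x)).symm
  have h1 := hU _ hu _ (he.offDiag_mem_commutatorSpan hij x)
  have h2 : e i * x * e j * u - u * (e i * x * e j) = e i * (x * u - u * x) * e j := by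
    rw [show e i * x * e j * u - u * (e i * x * e j) =
      e i * x * (e j * u) - (u * e i) * x * e j by noncomm_ring, hcomm, ← hcomm i]
    noncomm_ring
  rw [h2] at h1
  have h3 := hzero i j hij _ h1
  rw [← h2] at h3
  exact (sub_eq_zero.1 h3).symm

end

/-- Nonzero central elements of a simple algebra lie in the span of the commutators only if `1`
does. -/
theorem _root_.IsSimpleRing.eq_zero_of_mem_commutatorSpan_of_central
    (h1 : (1 : A) ∉ commutatorSpan K A) {z : A} (hz : z ∈ commutatorSpan K A)
    (hc : ∀ x, x * z = z * x) : z = 0 := by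
  by_contra h0
  obtain ⟨y, hy⟩ : ∃ y, y * z = 1 := by
    let W : Submodule K A := LinearMap.range (LinearMap.mulRight K z)
    have : (1 : A) ∈ W := IsSimpleRing.mem_of_forall_mul_mul_mem W h0
      (fun a b => ⟨a * b, by simp [mul_assoc, hc b]⟩) 1
    obtain ⟨y, hy⟩ := this
    exact ⟨y, by simpa using hy⟩
  have hyc : ∀ x, x * y = y * x := fun x => by
    calc x * y = (y * z) * (x * y) := by rw [hy, one_mul]
      _ = y * (z * x) * y := by noncomm_ring
      _ = y * x * (z * y) := by rw [← hc]; noncomm_ring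
      _ = y * x := by rw [← hc, hy, mul_one]
  apply h1
  rw [← hy]
  -- For central `y`, `y [a, b] = [y a, b]`.
  have : commutatorSpan K A ≤ (commutatorSpan K A).comap (LinearMap.mulLeft K y) := by
    refine Submodule.span_le.2 ?_
    rintro _ ⟨a, b, rfl⟩
    refine Submodule.subset_span ⟨y * a, b, ?_⟩
    simp only [LinearMap.mulLeft_apply]
    rw [mul_sub, ← mul_assoc b y a, hyc b]
    noncomm_ring
  exact this hz

end CompleteOrthogonalIdempotents

/-! ### Monomials in Cohn families and the reduction of ideals to vertices. -/

namespace Leavitt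

/-- The family `P v`, `S e`, `T e` satisfies all relations of a Leavitt path algebra except (CK2),
and the `P v` add up to `1`. -/
structure IsCohnFamily {V E : Type*} [Fintype V] [DecidableEq V] [DecidableEq E]
    (G : DirectedGraph V E) {B : Type*} [Ring B] (P : V → B) (S T : E → B) : Prop where
  vertex_mul_vertex : ∀ v w, P v * P w = if v = w then P v else 0
  vertex_mul_edge : ∀ v e, P v * S e = if v = G.s e then S e else 0
  edge_mul_vertex : ∀ e v, S e * P v = if v = G.r e then S e else 0
  vertex_mul_ghost : ∀ v e, P v * T e = if v = G.r e then T e else 0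
  ghost_mul_vertex : ∀ e v, T e * P v = if v = G.s e then T e else 0
  ghost_mul_edge : ∀ e f, T e * S f = if e = f then P (G.r e) else 0
  sum_vertex : ∑ v, P v = 1

/-- The images of the generators under a family. -/
def familyMap {V E B : Type*} (P : V → B) (S T : E → B) : Gen V E → B
  | .vertex v => P v
  | .edge e => S e
  | .ghost e => T e

/-- The element `S μ * P v * T ν`, where `μ` and `ν` are sequences of edges. -/
def monomial {V E B : Type*} [Ring B] (P : V → B) (S T : E → B) (μ : List E) (v : V)
    (ν : List E) : B :=
  (μ.map S).prod * P v * (ν.map T).prod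

namespace IsCohnFamily

variable {K : Type*} [Field K] {V E : Type*} [Fintype V] [DecidableEq V] [DecidableEq E]
  {G : DirectedGraph V E} {B : Type*} [Ring B] [Algebra K B] {P : V → B} {S T : E → B}

theorem ghost_mul_monomial_nil (h : IsCohnFamily G P S T) (f : E) (v : V) (ν : List E) :
    T f * monomial P S T [] v ν =
      if v = G.s f then monomial P S T [] (G.r f) (f :: ν) else 0 := by
  simp only [monomial, List.map_nil, List.prod_nil, one_mul, List.map_cons, List.prod_cons]
  rw [← mul_assoc, h.ghost_mul_vertex, ← mul_assoc, h.vertex_mul_ghost, if_pos rfl]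
  split_ifs <;> simp

theorem vertex_mul_monomial (h : IsCohnFamily G P S T) (w : V) (μ : List E) (v : V) (ν : List E) :
    P w * monomial P S T μ v ν = monomial P S T μ v ν ∨ P w * monomial P S T μ v ν = 0 := by
  cases μ with
  | nil =>
    simp only [monomial, List.map_nil, List.prod_nil, one_mul]
    rw [← mul_assoc, h.vertex_mul_vertex]
    split_ifs with hvw
    · subst hvw; exact Or.inl rfl
    · simp
  | cons e μ =>
    simp only [monomial, List.map_cons, List.prod_cons, ← mul_assoc]
    rw [h.vertex_mul_edge]
    split_ifs <;> simp

omit [Fintype V] [DecidableEq V] [DecidableEq E] in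
theorem edge_mul_monomial (e : E) (μ : List E) (v : V) (ν : List E) :
    S e * monomial P S T μ v ν = monomial P S T (e :: μ) v ν := by
  simp [monomial, mul_assoc]

theorem ghost_mul_monomial_cons (h : IsCohnFamily G P S T) (f e : E) (μ : List E) (v : V)
    (ν : List E) :
    T f * monomial P S T (e :: μ) v ν =
      if f = e then P (G.r f) * monomial P S T μ v ν else 0 := by
  rw [← edge_mul_monomial, ← mul_assoc, h.ghost_mul_edge]
  split_ifs <;> simp

variable (K) in
/-- The subalgebra generated by a Cohn family is spanned by monomials. -/
theorem lift_mem_span_monomial (h : IsCohnFamily G P S T) (X : FreeAlgebra K (Gen V E)) :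
    FreeAlgebra.lift K (familyMap P S T) X ∈
      Submodule.span K {b | ∃ μ v ν, monomial P S T μ v ν = b} := by
  set M := Submodule.span K {b | ∃ μ v ν, monomial P S T μ v ν = b}
  have hmem : ∀ μ v ν, monomial P S T μ v ν ∈ M := fun μ v ν => Submodule.subset_span ⟨μ, v, ν, rfl⟩
  have hvert : ∀ w μ v ν, P w * monomial P S T μ v ν ∈ M := by
    intro w μ v ν
    rcases h.vertex_mul_monomial w μ v ν with h | h <;> rw [h]
    · exact hmem _ _ _
    · exact M.zero_mem
  have hgen : ∀ x μ v ν, familyMap P S T x * monomial P S T μ v ν ∈ M := by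
    rintro (w | e | e) μ v ν
    · exact hvert w μ v ν
    · simp only [familyMap]
      rw [edge_mul_monomial]
      exact hmem _ _ _
    · simp only [familyMap]
      cases μ with
      | nil => rw [h.ghost_mul_monomial_nil]; split_ifs; exacts [hmem _ _ _, M.zero_mem]
      | cons f μ =>
        rw [h.ghost_mul_monomial_cons]
        split_ifs
        exacts [hvert _ _ _ _, M.zero_mem]
  -- The span of the monomials is stable under left multiplication by generators and contains `1`.
  have hmul : ∀ m ∈ M, FreeAlgebra.lift K (familyMap P S T) X * m ∈ M := by
    induction X using FreeAlgebra.induction with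
    | grade0 k =>
      intro m hm
      rw [AlgHom.commutes, Algebra.algebraMap_eq_smul_one, smul_mul_assoc, one_mul]
      exact M.smul_mem k hm
    | grade1 x =>
      intro m hm
      rw [FreeAlgebra.lift_ι_apply]
      have : M ≤ M.comap (LinearMap.mulLeft K (familyMap P S T x)) := by
        refine Submodule.span_le.2 ?_
        rintro _ ⟨μ, v, ν, rfl⟩
        exact hgen x μ v ν
      exact this hm
    | mul a b ha hb => intro m hm; rw [map_mul, mul_assoc]; exact ha _ (hb m hm)
    | add a b ha hb => intro m hm; rw [map_add, add_mul]; exact M.add_mem (ha m hm) (hb m hm)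
  have h1 : (1 : B) ∈ M := by
    rw [← h.sum_vertex]
    refine M.sum_mem fun v _ => ?_
    simpa [monomial] using hmem [] v []
  simpa using hmul 1 h1

/-- The span of the monomials with at most `m` ghost edges. -/
def ghostSpan (K : Type*) [Field K] {V E B : Type*} [Ring B] [Algebra K B] (P : V → B)
    (S T : E → B) (m : ℕ) : Submodule K B :=
  Submodule.span K {b | ∃ μ v ν, ν.length ≤ m ∧ monomial P S T μ v ν = b}

/-- The span of the real monomials of length between `k` and `m`. -/
def pathSpan (K : Type*) [Field K] {V E B : Type*} [Ring B] [Algebra K B] (P : V → B)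
    (S T : E → B) (k m : ℕ) : Submodule K B :=
  Submodule.span K {b | ∃ μ v, k ≤ μ.length ∧ μ.length ≤ m ∧ monomial P S T μ v [] = b}

theorem monomial_mul_vertex (h : IsCohnFamily G P S T) (w : V) (μ : List E) (v : V) (ν : List E) :
    monomial P S T μ v ν * P w = monomial P S T μ v ν ∨ monomial P S T μ v ν * P w = 0 := by
  rcases List.eq_nil_or_concat ν with rfl | ⟨ν, e, rfl⟩
  · simp only [monomial, List.map_nil, List.prod_nil, mul_one]
    rw [mul_assoc, h.vertex_mul_vertex]
    split_ifs <;> simp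
  · simp only [monomial, List.concat_eq_append, List.map_append, List.prod_append, List.map_cons,
      List.map_nil, List.prod_singleton, mul_assoc]
    rw [h.ghost_mul_vertex]
    split_ifs <;> simp

theorem monomial_concat_mul_edge (h : IsCohnFamily G P S T) (μ : List E) (v : V) (ν : List E)
    (f e : E) : monomial P S T μ v (ν ++ [f]) * S e =
      if f = e then monomial P S T μ v ν * P (G.r f) else 0 := by
  simp only [monomial, List.map_append, List.prod_append, List.map_cons,
      List.map_nil, List.prod_singleton, mul_assoc]
  rw [h.ghost_mul_edge]
  split_ifs <;> simp

theorem monomial_nil_mul_edge (h : IsCohnFamily G P S T) (μ : List E) (v : V) (e : E) :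
    monomial P S T μ v [] * S e =
      if v = G.s e then monomial P S T (μ ++ [e]) (G.r e) [] else 0 := by
  simp only [monomial, List.map_append, List.prod_append, List.map_cons,
      List.map_nil, List.prod_singleton, mul_assoc, List.prod_nil, mul_one]
  rw [h.vertex_mul_edge, h.edge_mul_vertex]
  split_ifs <;> simp_all

/-- An edge on the right cancels the last ghost edge of a monomial or kills the monomial; a monomial
without ghost edges stays free of them. -/
theorem mul_edge_mem_ghostSpan (h : IsCohnFamily G P S T) {m : ℕ} {x : B}
    (hx : x ∈ ghostSpan K P S T (m + 1)) (e : E) : x * S e ∈ ghostSpan K P S T m := by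
  have : ghostSpan K P S T (m + 1) ≤ (ghostSpan K P S T m).comap (LinearMap.mulRight K (S e)) := by
    refine Submodule.span_le.2 ?_
    rintro _ ⟨μ, v, ν, hν, rfl⟩
    change monomial P S T μ v ν * S e ∈ ghostSpan K P S T m
    rcases List.eq_nil_or_concat ν with rfl | ⟨ν, f, rfl⟩
    · rw [h.monomial_nil_mul_edge]
      split_ifs
      · exact Submodule.subset_span ⟨_, _, _, by simp, rfl⟩
      · exact Submodule.zero_mem _
    · rw [List.concat_eq_append, h.monomial_concat_mul_edge]
      split_ifs
      · rcases h.monomial_mul_vertex (G.r f) μ v ν with h | h <;> rw [h]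
        · exact Submodule.subset_span ⟨_, _, _, by simpa using hν, rfl⟩
        · exact Submodule.zero_mem _
      · exact Submodule.zero_mem _
  exact this hx

theorem ghost_mul_mem_pathSpan (h : IsCohnFamily G P S T) {m : ℕ} {x : B}
    (hx : x ∈ pathSpan K P S T 1 (m + 1)) (e : E) : T e * x ∈ pathSpan K P S T 0 m := by
  have : pathSpan K P S T 1 (m + 1) ≤
      (pathSpan K P S T 0 m).comap (LinearMap.mulLeft K (T e)) := by
    refine Submodule.span_le.2 ?_
    rintro _ ⟨μ, v, h1, hμ, rfl⟩
    change T e * monomial P S T μ v [] ∈ pathSpan K P S T 0 m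
    cases μ with
    | nil => simp at h1
    | cons f μ =>
      rw [h.ghost_mul_monomial_cons]
      split_ifs
      · rcases h.vertex_mul_monomial (G.r e) μ v [] with h | h <;> rw [h]
        · exact Submodule.subset_span ⟨_, _, by simp, by simpa using hμ, rfl⟩
        · exact Submodule.zero_mem _
      · exact Submodule.zero_mem _
  exact this hx

omit [DecidableEq E] in
theorem exists_eq_sum_add_mem_pathSpan {m : ℕ} {x : B}
    (hx : x ∈ pathSpan K P S T 0 m) :
    ∃ c : V → K, ∃ y ∈ pathSpan K P S T 1 m, x = ∑ v, c v • P v + y := by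
  induction hx using Submodule.span_induction with
  | mem x hx =>
    obtain ⟨μ, v, -, hμ, rfl⟩ := hx
    cases μ with
    | nil => exact ⟨Pi.single v 1, 0, Submodule.zero_mem _, by
        simp [monomial, Pi.single_apply]⟩
    | cons e μ => exact ⟨0, _, Submodule.subset_span ⟨e :: μ, v, by simp, hμ, rfl⟩, by simp⟩
  | zero => exact ⟨0, 0, Submodule.zero_mem _, by simp⟩
  | add x y _ _ hx hy =>
    obtain ⟨c, x', hx', rfl⟩ := hx
    obtain ⟨d, y', hy', rfl⟩ := hy
    refine ⟨c + d, x' + y', Submodule.add_mem _ hx' hy', ?_⟩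
    simp only [Pi.add_apply, add_smul, Finset.sum_add_distrib]
    abel
  | smul k x _ hx =>
    obtain ⟨c, x', hx', rfl⟩ := hx
    refine ⟨k • c, k • x', Submodule.smul_mem _ _ hx', ?_⟩
    simp [smul_add, Finset.smul_sum, smul_smul]

/-- `T_e ^ N` annihilates `α` unless `α` is a power of `e`. In that case fewer factors `T_e` than
`S_e` remain, and `T_f S_e = 0` finishes. -/
theorem ghost_mul_pow_mul_monomial_mul (h : IsCohnFamily G P S T) {e f : E} (hef : e ≠ f)
    (he : G.s e = G.r e) (hf : G.s f = G.r e) (α : List E) (w : V) :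
    ∀ N M : ℕ, α.length ≤ N → N < M + α.length →
      T f * T e ^ N * monomial P S T α w [] * (S e ^ M * S f) = 0 := by
  induction α with
  | nil =>
    intro N M _ hNM
    simp only [List.length_nil, add_zero] at hNM
    obtain ⟨k, rfl⟩ := Nat.exists_eq_add_of_lt hNM
    have hT : T f * T e ^ N * P w = if w = G.r e then T f * T e ^ N else 0 := by
      cases N with
      | zero => rw [pow_zero, mul_one, h.ghost_mul_vertex, hf]
      | succ N => rw [pow_succ, mul_assoc, mul_assoc, h.ghost_mul_vertex, he]; split_ifs <;> simp
    have hTS : ∀ n, T e ^ n * S e ^ (n + k + 1) = S e ^ (k + 1) := by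
      intro n
      induction n with
      | zero => simp
      | succ n ih =>
        rw [pow_succ, show n + 1 + k + 1 = (n + k + 1) + 1 by ring, pow_succ' (S e), mul_assoc,
          ← mul_assoc (T e), h.ghost_mul_edge, if_pos rfl]
        rw [show n + k + 1 = (n + k) + 1 by ring, pow_succ' (S e), ← mul_assoc (P _),
          h.vertex_mul_edge, if_pos he.symm, ← pow_succ' (S e)]
        exact ih
    have : T f * T e ^ N * (S e ^ (N + k + 1) * S f) = 0 := by
      rw [mul_assoc, ← mul_assoc (T e ^ N), hTS, pow_succ', mul_assoc, ← mul_assoc (T f),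
        h.ghost_mul_edge, if_neg hef.symm, zero_mul]
    simp only [monomial, List.map_nil, List.prod_nil, one_mul, mul_one]
    rw [hT]
    split_ifs
    · exact this
    · simp
  | cons g α ih =>
    intro N M hN hNM
    simp only [List.length_cons] at hN hNM
    obtain ⟨N, rfl⟩ := Nat.exists_eq_succ_of_ne_zero (show N ≠ 0 by omega)
    rw [pow_succ, mul_assoc (T f), mul_assoc (T e ^ N), h.ghost_mul_monomial_cons]
    split_ifs
    · rw [← mul_assoc (T f), ← mul_assoc (T f * T e ^ N)]
      have hT : T f * T e ^ N * P (G.r e) = T f * T e ^ N := by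
        cases N with
        | zero => rw [pow_zero, mul_one, h.ghost_mul_vertex, if_pos hf.symm]
        | succ N => rw [pow_succ, mul_assoc, mul_assoc, h.ghost_mul_vertex, if_pos he.symm]
      rw [hT]
      exact ih N M (by omega) (by omega)
    · simp

theorem ghost_pow_mul_pow (h : IsCohnFamily G P S T) {e f : E}
    (he : G.s e = G.r e) (hf : G.s f = G.r e) (N : ℕ) :
    T f * T e ^ N * P (G.r e) * (S e ^ N * S f) = P (G.r f) := by
  induction N with
  | zero =>
    simp only [pow_zero, mul_one, one_mul]
    rw [h.ghost_mul_vertex, if_pos hf.symm, h.ghost_mul_edge, if_pos rfl]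
  | succ N ih =>
    calc T f * T e ^ (N + 1) * P (G.r e) * (S e ^ (N + 1) * S f)
        = T f * T e ^ N * (T e * P (G.r e) * S e) * (S e ^ N * S f) := by
          rw [pow_succ, pow_succ' (S e)]; simp only [mul_assoc]
      _ = P (G.r f) := by
          rw [h.ghost_mul_vertex, if_pos he.symm, h.ghost_mul_edge, if_pos rfl, ih]

omit [Fintype V] [DecidableEq V] [DecidableEq E] in
theorem exists_mem_ghostSpan {x : B}
    (hx : x ∈ Submodule.span K {b | ∃ μ v ν, monomial P S T μ v ν = b}) :
    ∃ m, x ∈ ghostSpan K P S T m := by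
  have mono : ∀ {m n : ℕ}, m ≤ n → ghostSpan K P S T m ≤ ghostSpan K P S T n := fun hmn =>
    Submodule.span_mono fun _ ⟨μ, v, ν, hν, h⟩ => ⟨μ, v, ν, hν.trans hmn, h⟩
  induction hx using Submodule.span_induction with
  | mem x hx =>
    obtain ⟨μ, v, ν, rfl⟩ := hx
    exact ⟨ν.length, Submodule.subset_span ⟨μ, v, ν, le_rfl, rfl⟩⟩
  | zero => exact ⟨0, Submodule.zero_mem _⟩
  | add x y _ _ hx hy =>
    obtain ⟨m, hm⟩ := hx
    obtain ⟨n, hn⟩ := hy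
    exact ⟨max m n, Submodule.add_mem _ (mono (le_max_left m n) hm) (mono (le_max_right m n) hn)⟩
  | smul k x _ hx =>
    obtain ⟨m, hm⟩ := hx
    exact ⟨m, Submodule.smul_mem _ k hm⟩

omit [Fintype V] [DecidableEq V] [DecidableEq E] in
theorem exists_mem_pathSpan {x : B} (hx : x ∈ ghostSpan K P S T 0) :
    ∃ m, x ∈ pathSpan K P S T 0 m := by
  have mono : ∀ {m n : ℕ}, m ≤ n → pathSpan K P S T 0 m ≤ pathSpan K P S T 0 n := fun hmn =>
    Submodule.span_mono fun _ ⟨μ, v, h0, hμ, h⟩ => ⟨μ, v, h0, hμ.trans hmn, h⟩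
  induction hx using Submodule.span_induction with
  | mem x hx =>
    obtain ⟨μ, v, ν, hν, rfl⟩ := hx
    obtain rfl : ν = [] := by simpa using hν
    exact ⟨μ.length, Submodule.subset_span ⟨μ, v, by simp, le_rfl, rfl⟩⟩
  | zero => exact ⟨0, Submodule.zero_mem _⟩
  | add x y _ _ hx hy =>
    obtain ⟨m, hm⟩ := hx
    obtain ⟨n, hn⟩ := hy
    exact ⟨max m n, Submodule.add_mem _ (mono (le_max_left m n) hm) (mono (le_max_right m n) hn)⟩
  | smul k x _ hx =>
    obtain ⟨m, hm⟩ := hx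
    exact ⟨m, Submodule.smul_mem _ k hm⟩

section Ideal

variable [Fintype E] (hsum : ∑ e, S e * T e = 1)
  (I : TwoSidedIdeal B)

include hsum

/-- From `x = ∑ (x S_e) T_e`, some `x S_e` is nonzero, and it involves fewer ghost edges. -/
theorem exists_ne_zero_mem_ghostSpan_zero (h : IsCohnFamily G P S T) (m : ℕ) {x : B}
    (hx : x ∈ I) (hx0 : x ≠ 0) (hm : x ∈ ghostSpan K P S T m) :
    ∃ y ∈ I, y ≠ 0 ∧ y ∈ ghostSpan K P S T 0 := by
  induction m generalizing x with
  | zero => exact ⟨x, hx, hx0, hm⟩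
  | succ m ih =>
    obtain ⟨e, he⟩ : ∃ e, x * S e ≠ 0 := by
      by_contra! hall
      apply hx0
      rw [← mul_one x, ← hsum, Finset.mul_sum]
      exact Finset.sum_eq_zero fun e _ => by rw [← mul_assoc, hall, zero_mul]
    exact ih (I.mul_mem_right _ _ hx) he (h.mul_edge_mem_ghostSpan hm e)

/-- If all vertex coefficients vanish, `x = ∑ S_e (T_e x)` gives a nonzero `T_e x` made of shorter
paths; at length `0` only vertices remain. -/
theorem exists_vertex_coeff_ne_zero (h : IsCohnFamily G P S T) (m : ℕ) {x : B}
    (hx : x ∈ I) (hx0 : x ≠ 0) (hm : x ∈ pathSpan K P S T 0 m) :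
    ∃ (n : ℕ) (c : V → K) (y : B), y ∈ pathSpan K P S T 1 n ∧ (∃ v, c v ≠ 0) ∧
      ∑ v, c v • P v + y ∈ I := by
  induction m generalizing x with
  | zero =>
    obtain ⟨c, y, hy, rfl⟩ := exists_eq_sum_add_mem_pathSpan hm
    refine ⟨0, c, y, hy, ?_, hx⟩
    by_contra! hc
    apply hx0
    have hy0 : pathSpan K P S T 1 0 ≤ ⊥ := by
      refine Submodule.span_le.2 ?_
      rintro _ ⟨μ, v, h1, h2, -⟩
      omega
    simpa [hc] using hy0 hy
  | succ m ih =>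
    obtain ⟨c, y, hy, rfl⟩ := exists_eq_sum_add_mem_pathSpan hm
    by_cases hc : ∃ v, c v ≠ 0
    · exact ⟨m + 1, c, y, hy, hc, hx⟩
    push Not at hc
    simp only [hc, zero_smul, Finset.sum_const_zero, zero_add] at hx hx0
    obtain ⟨e, he⟩ : ∃ e, T e * y ≠ 0 := by
      by_contra! hall
      apply hx0
      rw [← one_mul y, ← hsum, Finset.sum_mul]
      exact Finset.sum_eq_zero fun e _ => by rw [mul_assoc, hall, mul_zero]
    exact ih (I.mul_mem_left _ _ hx) he (h.ghost_mul_mem_pathSpan hy e)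

/-- If any two vertices are joined by two distinct edges, a nonzero ideal contains `1`. -/
theorem one_mem_of_ne_zero_mem (h : IsCohnFamily G P S T)
    (hG : ∀ v w, ∃ e f, e ≠ f ∧ G.s e = v ∧ G.s f = v ∧ G.r e = w ∧ G.r f = w) {x : B}
    (hspan : x ∈ Submodule.span K {b | ∃ μ v ν, monomial P S T μ v ν = b})
    (hx : x ∈ I) (hx0 : x ≠ 0) : (1 : B) ∈ I := by
  have hsmul : ∀ (k : K) {b : B}, b ∈ I → k • b ∈ I := fun k b hb => by
    rw [Algebra.smul_def]; exact I.mul_mem_left _ _ hb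
  obtain ⟨m, hm⟩ := exists_mem_ghostSpan hspan
  obtain ⟨y, hy, hy0, hy1⟩ := exists_ne_zero_mem_ghostSpan_zero hsum I h m hx hx0 hm
  obtain ⟨n, hn⟩ := exists_mem_pathSpan hy1
  obtain ⟨N, c, z, hz, ⟨v, hv⟩, hmem⟩ := exists_vertex_coeff_ne_zero hsum I h n hy hy0 hn
  obtain ⟨e, f, hef, hse, hsf, hre, hrf⟩ := hG v v
  have he : G.s e = G.r e := hse.trans hre.symm
  have hf : G.s f = G.r e := hsf.trans hre.symm
  -- `N` bounds the lengths of all paths involved and these lengths are positive, so compression by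
  -- powers of the loop `e` kills everything but the vertex term.
  have hz0 : ∀ z ∈ pathSpan K P S T 1 N, T f * T e ^ N * z * (S e ^ N * S f) = 0 := by
    intro z hz
    induction hz using Submodule.span_induction with
    | mem z hz =>
      obtain ⟨μ, w, h1, h2, rfl⟩ := hz
      exact h.ghost_mul_pow_mul_monomial_mul hef he hf μ w N N h2 (by omega)
    | zero => simp
    | add a b _ _ ha hb => rw [mul_add, add_mul, ha, hb, add_zero]
    | smul k a _ ha => rw [mul_smul_comm, smul_mul_assoc, ha, smul_zero]
  have hvI : c v • P v ∈ I := by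
    have h1 := I.mul_mem_right _ (S e ^ N * S f) (I.mul_mem_left (T f * T e ^ N) _
      (I.mul_mem_left (P v) _ hmem))
    have h2 : P v * (∑ w, c w • P w + z) = c v • P v + P v * z := by
      rw [mul_add, Finset.mul_sum, Finset.sum_eq_single v]
      · rw [mul_smul_comm, h.vertex_mul_vertex, if_pos rfl]
      · intro w _ hw
        rw [mul_smul_comm, h.vertex_mul_vertex, if_neg hw.symm, smul_zero]
      · simp
    have h3 : P v * z ∈ pathSpan K P S T 1 N := by
      have : pathSpan K P S T 1 N ≤
          (pathSpan K P S T 1 N).comap (LinearMap.mulLeft K (P v)) := by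
        refine Submodule.span_le.2 ?_
        rintro _ ⟨μ, w, h1, h2, rfl⟩
        change P v * monomial P S T μ w [] ∈ pathSpan K P S T 1 N
        rcases h.vertex_mul_monomial v μ w [] with h | h <;> rw [h]
        · exact Submodule.subset_span ⟨_, _, h1, h2, rfl⟩
        · exact Submodule.zero_mem _
      exact this hz
    rw [h2, mul_add, add_mul, hz0 _ h3, add_zero, mul_smul_comm, smul_mul_assoc] at h1
    have h4 := h.ghost_pow_mul_pow he hf N
    rw [hre] at h4
    rwa [h4, hrf] at h1
  have hvI' : P v ∈ I := by
    have := hsmul (c v)⁻¹ hvI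
    rwa [smul_smul, inv_mul_cancel₀ hv, one_smul] at this
  -- An edge `g` from `v` to `w` gives `P w = T_g P_v S_g`, so the ideal contains every vertex.
  rw [← h.sum_vertex]
  refine sum_mem fun w _ => ?_
  obtain ⟨g, -, -, hs, -, hr, -⟩ := hG v w
  have := I.mul_mem_right _ (S g) (I.mul_mem_left (T g) _ hvI')
  rwa [h.ghost_mul_vertex, if_pos hs.symm, h.ghost_mul_edge, if_pos rfl, hr] at this

end Ideal

end IsCohnFamily

end Leavitt

/-! ### The generators of a Leavitt path algebra as a Cohn family. -/

namespace LeavittPathAlgebra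

open Leavitt

variable (K : Type*) [Field K] {V E : Type*} [Fintype V] [DecidableEq V] [DecidableEq E]
  (G : DirectedGraph V E)

theorem isCohnFamily : IsCohnFamily G (fun v => of K G (.vertex v)) (fun e => of K G (.edge e))
    (fun e => of K G (.ghost e)) := by
  have h := isFamily K G
  refine ⟨fun v w => ?_, fun v e => ?_, fun e v => ?_, fun v e => ?_, fun e v => ?_, fun e f => ?_,
    sum_vertex K G⟩
  · split_ifs with hvw
    · subst hvw; exact h.vertex_mul_self v
    · exact h.vertex_mul_of_ne v w hvw
  · split_ifs with hv
    · subst hv; exact h.source_mul_edge e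
    · have := h.source_mul_edge e
      beta_reduce at this
      rw [← this, ← mul_assoc, h.vertex_mul_of_ne _ _ hv, zero_mul]
  · split_ifs with hv
    · subst hv; exact h.edge_mul_range e
    · have := h.edge_mul_range e
      beta_reduce at this
      rw [← this, mul_assoc, h.vertex_mul_of_ne _ _ (Ne.symm hv), mul_zero]
  · split_ifs with hv
    · subst hv; exact h.range_mul_ghost e
    · have := h.range_mul_ghost e
      beta_reduce at this
      rw [← this, ← mul_assoc, h.vertex_mul_of_ne _ _ hv, zero_mul]
  · split_ifs with hv
    · subst hv; exact h.ghost_mul_source e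
    · have := h.ghost_mul_source e
      beta_reduce at this
      rw [← this, mul_assoc, h.vertex_mul_of_ne _ _ (Ne.symm hv), mul_zero]
  · split_ifs with hef
    · subst hef; exact h.ghost_mul_edge_self e
    · exact h.ghost_mul_edge_of_ne e f hef

omit [DecidableEq V] [DecidableEq E] in
theorem mkAlgHom_eq_lift : RingQuot.mkAlgHom K (Rel K G) = FreeAlgebra.lift K
    (familyMap (fun v => of K G (.vertex v)) (fun e => of K G (.edge e))
      (fun e => of K G (.ghost e))) := by
  ext x
  rcases x with v | e | e <;> simp [familyMap, of, gen]

theorem mem_span_monomial (x : LeavittPathAlgebra K G) :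
    x ∈ Submodule.span K {b | ∃ μ v ν, monomial (fun v => of K G (.vertex v))
      (fun e => of K G (.edge e)) (fun e => of K G (.ghost e)) μ v ν = b} := by
  obtain ⟨X, rfl⟩ := RingQuot.mkAlgHom_surjective K (Rel K G) x
  rw [mkAlgHom_eq_lift]
  exact (isCohnFamily K G).lift_mem_span_monomial K X

omit [DecidableEq V] [DecidableEq E] in
theorem sum_edge_mul_ghost [Fintype E] (hG : ∀ v, ∃ e, G.s e = v) :
    ∑ e, of K G (.edge e) * of K G (.ghost e) = 1 := by
  classical
  rw [← sum_vertex K G, ← Finset.sum_fiberwise Finset.univ G.s]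
  refine Finset.sum_congr rfl fun v _ => ?_
  have hv : G.IsRegular v := ⟨Set.toFinite _, hG v⟩
  have := (isFamily K G).vertex_eq_sum v hv
  beta_reduce at this
  rw [this]
  exact Finset.sum_congr (by ext; simp) fun _ _ => rfl

end LeavittPathAlgebra

/-! ### Representations on functions on paths; nontriviality and simplicity. -/

namespace Leavitt

/-- An abstract set of paths in a graph: a path has a starting vertex, can be extended by an edge that ends
there, and its first edge can be removed whenever `uncons` is defined on it. -/
structure PathModel {V E : Type*} (G : DirectedGraph V E) (X : Type*) where
  /-- the starting vertex -/
  start : X → V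
  /-- extension by an edge -/
  cons : E → X → X
  /-- the first edge and the rest of a path -/
  uncons : X → Option (E × X)
  uncons_cons : ∀ e x, start x = G.r e → uncons (cons e x) = some (e, x)
  start_of_uncons : ∀ {y e x}, uncons y = some (e, x) → start x = G.r e
  cons_of_uncons : ∀ {y e x}, uncons y = some (e, x) → cons e x = y
  start_cons : ∀ e x, start x = G.r e → start (cons e x) = G.s e

namespace PathModel

variable (K : Type*) [Field K] {V E X : Type*} [DecidableEq V] [DecidableEq E]
  {G : DirectedGraph V E} (M : PathModel G X)

/-- The operator by which a vertex acts on functions on paths. -/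
def vertexOp (v : V) : Module.End K (X → K) where
  toFun f x := if M.start x = v then f x else 0
  map_add' f g := by ext x; simp only [Pi.add_apply]; split_ifs <;> simp
  map_smul' k f := by ext x; simp

/-- The operator by which an edge acts on functions on paths. -/
def edgeOp (e : E) : Module.End K (X → K) where
  toFun f y := (M.uncons y).elim 0 fun p => if p.1 = e then f p.2 else 0
  map_add' f g := by
    ext y
    rcases h : M.uncons y with _ | p
    · simp [h]
    · simp only [h, Option.elim_some, Pi.add_apply]; split_ifs <;> simp
  map_smul' k f := by
    ext y
    rcases h : M.uncons y with _ | p <;> simp [h]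

/-- The operator by which a ghost edge acts on functions on paths. -/
def ghostOp (e : E) : Module.End K (X → K) where
  toFun f x := if M.start x = G.r e then f (M.cons e x) else 0
  map_add' f g := by ext x; simp only [Pi.add_apply]; split_ifs <;> simp
  map_smul' k f := by ext x; simp

omit [DecidableEq E] in
theorem vertexOp_apply (v : V) (f : X → K) (x : X) :
    M.vertexOp K v f x = if M.start x = v then f x else 0 := rfl

omit [DecidableEq V] in
theorem edgeOp_apply (e : E) (f : X → K) (y : X) :
    M.edgeOp K e f y = (M.uncons y).elim 0 fun p => if p.1 = e then f p.2 else 0 := rfl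

omit [DecidableEq E] in
theorem ghostOp_apply (e : E) (f : X → K) (x : X) :
    M.ghostOp K e f x = if M.start x = G.r e then f (M.cons e x) else 0 := rfl

/-- (CK2) is the relation that may fail: where `uncons` is undefined, every `edgeOp` gives the value
`0`. -/
theorem isCohnFamily [Fintype V] :
    IsCohnFamily G (M.vertexOp K) (M.edgeOp K) (M.ghostOp K) := by
  have start_eq : ∀ {y e x}, M.uncons y = some (e, x) → M.start y = G.s e := fun {y e x} h => by
    rw [← M.cons_of_uncons h, M.start_cons _ _ (M.start_of_uncons h)]
  refine ⟨fun v w => ?_, fun v e => ?_, fun e v => ?_, fun v e => ?_, fun e v => ?_, fun e f => ?_,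
    ?_⟩
  · ext1 f; ext y
    rw [Module.End.mul_apply, vertexOp_apply, vertexOp_apply]
    split_ifs with h1 h2 h3 h3 <;> simp_all [vertexOp_apply]
  · ext1 f; ext y
    rw [Module.End.mul_apply, vertexOp_apply, edgeOp_apply]
    rcases h : M.uncons y with _ | ⟨e', x⟩
    · split_ifs <;> simp [edgeOp_apply, h]
    · have := start_eq h
      split_ifs <;> simp [edgeOp_apply, h] <;> grind
  · ext1 f; ext y
    rw [Module.End.mul_apply, edgeOp_apply]
    rcases h : M.uncons y with _ | ⟨e', x⟩
    · split_ifs <;> simp [edgeOp_apply, h]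
    · have := M.start_of_uncons h
      split_ifs <;> simp [edgeOp_apply, vertexOp_apply, h] <;> grind
  · ext1 f; ext y
    rw [Module.End.mul_apply, vertexOp_apply, ghostOp_apply]
    split_ifs <;> simp_all [ghostOp_apply]
  · ext1 f; ext y
    rw [Module.End.mul_apply, ghostOp_apply, vertexOp_apply]
    have := M.start_cons e y
    split_ifs <;> simp [ghostOp_apply] <;> grind
  · ext1 g; ext y
    rw [Module.End.mul_apply, ghostOp_apply, edgeOp_apply]
    by_cases hy : M.start y = G.r e
    · rw [if_pos hy, M.uncons_cons e y hy]
      split_ifs with hef <;> simp [vertexOp_apply, hy, hef]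
    · rw [if_neg hy]
      split_ifs with hef <;> simp [vertexOp_apply, hy]
  · ext1 f; ext y
    simp [LinearMap.sum_apply, Finset.sum_apply, vertexOp_apply]

/-- (CK2) holds on the paths that have a first edge. -/
theorem sum_edgeOp_mul_ghostOp_apply (v : V) (F : Finset E) (hF : ∀ e, e ∈ F ↔ G.s e = v)
    (f : X → K) {y : X} (hy : M.uncons y ≠ none) :
    (∑ e ∈ F, M.edgeOp K e * M.ghostOp K e) f y = M.vertexOp K v f y := by
  obtain ⟨⟨e', x⟩, h⟩ := Option.ne_none_iff_exists'.1 hy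
  have h1 := M.start_of_uncons h
  have h2 := M.cons_of_uncons h
  have h3 := M.start_cons e' x h1
  rw [h2] at h3
  simp only [LinearMap.sum_apply, Finset.sum_apply, Module.End.mul_apply, edgeOp_apply, h,
    Option.elim_some, ghostOp_apply, vertexOp_apply, Finset.sum_ite_eq, hF, h3, h1, h2, if_true]

end PathModel

end Leavitt

namespace LeavittPathAlgebra

open Leavitt

variable (K : Type*) [Field K] {V E : Type*} [Fintype V] [Fintype E] (G : DirectedGraph V E)

omit [Fintype V] in
-- Over each vertex both sides have a countably infinite fibre, as every vertex emits an edge. The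
-- bijection turns `V × ℕ` into a path model in which every point has a first edge.
theorem exists_equiv_fst_eq_source (hG : ∀ v, ∃ e, G.s e = v) :
    ∃ φ : E × ℕ ≃ V × ℕ, ∀ e n, (φ (e, n)).1 = G.s e := by
  have h : ∀ v, Nonempty ({e // G.s e = v} × ℕ ≃ ℕ) := fun v => by
    obtain ⟨e, he⟩ := hG v
    have : Nonempty {e // G.s e = v} := ⟨⟨e, he⟩⟩
    exact nonempty_equiv_of_countable
  let φ : E × ℕ ≃ V × ℕ :=
    (((Equiv.sigmaFiberEquiv G.s).symm.prodCongr (Equiv.refl ℕ)).trans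
      (Equiv.sigmaProdDistrib _ _)).trans
        ((Equiv.sigmaCongrRight fun v => (h v).some).trans (Equiv.sigmaEquivProd V ℕ))
  exact ⟨φ, fun e n => rfl⟩

theorem nontrivial [Nonempty V] (hG : ∀ v, ∃ e, G.s e = v) :
    Nontrivial (LeavittPathAlgebra K G) := by
  classical
  obtain ⟨φ, hφ⟩ := exists_equiv_fst_eq_source G hG
  -- `cons e x` may ignore `x.1`, which equals `G.r e` whenever the extension is legitimate.
  -- `uncons` is defined everywhere, so (CK2) holds as well.
  let M : PathModel G (V × ℕ) :=
    { start := Prod.fst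
      cons := fun e x => φ (e, x.2)
      uncons := fun y => some ((φ.symm y).1, (G.r (φ.symm y).1, (φ.symm y).2))
      uncons_cons := fun e x hx => by simp [← hx]
      start_of_uncons := fun {y e x} h => by
        simp only [Option.some.injEq, Prod.mk.injEq] at h
        rw [← h.2, h.1]
      cons_of_uncons := fun {y e x} h => by
        simp only [Option.some.injEq, Prod.mk.injEq] at h
        rw [← h.2, ← h.1]
        simp
      start_cons := fun e x _ => hφ e x.2 }
  have hM := M.isCohnFamily K
  have hF : IsFamily G (M.vertexOp K) (M.edgeOp K) (M.ghostOp K) :=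
    { vertex_mul_self := fun v => by rw [hM.vertex_mul_vertex, if_pos rfl]
      vertex_mul_of_ne := fun v w h => by rw [hM.vertex_mul_vertex, if_neg h]
      source_mul_edge := fun e => by rw [hM.vertex_mul_edge, if_pos rfl]
      edge_mul_range := fun e => by rw [hM.edge_mul_vertex, if_pos rfl]
      range_mul_ghost := fun e => by rw [hM.vertex_mul_ghost, if_pos rfl]
      ghost_mul_source := fun e => by rw [hM.ghost_mul_vertex, if_pos rfl]
      ghost_mul_edge_self := fun e => by rw [hM.ghost_mul_edge, if_pos rfl]
      ghost_mul_edge_of_ne := fun e f h => by rw [hM.ghost_mul_edge, if_neg h]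
      vertex_eq_sum := fun v h => by
        ext1 f; ext y
        exact (M.sum_edgeOp_mul_ghostOp_apply K v _ (by simp) f (by simp [M])).symm }
  obtain ⟨F, ⟨hFv, -, -⟩, -⟩ := existsUnique_lift K G hF
  obtain ⟨v⟩ := ‹Nonempty V›
  refine ⟨of K G (.vertex v), 0, fun h0 => ?_⟩
  have h1 := hFv v
  rw [h0, map_zero] at h1
  have h2 := congrFun (LinearMap.congr_fun h1 (fun _ => 1)) (v, 0)
  simp [PathModel.vertexOp_apply, M] at h2

theorem isSimpleRing [Nonempty V]
    (hG : ∀ v w, ∃ e f, e ≠ f ∧ G.s e = v ∧ G.s f = v ∧ G.r e = w ∧ G.r f = w) :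
    IsSimpleRing (LeavittPathAlgebra K G) := by
  classical
  have hG' : ∀ v, ∃ e, G.s e = v := fun v => by
    obtain ⟨e, -, -, h, -⟩ := hG v v
    exact ⟨e, h⟩
  have := nontrivial K G hG'
  refine .of_eq_bot_or_eq_top fun I => or_iff_not_imp_left.2 fun hI => ?_
  obtain ⟨x, hx, hx0⟩ := SetLike.exists_of_lt (bot_lt_iff_ne_bot.2 hI)
  rw [← I.one_mem_iff]
  exact IsCohnFamily.one_mem_of_ne_zero_mem (K := K) (sum_edge_mul_ghost K G hG') I
    (isCohnFamily K G) hG (mem_span_monomial K G x) hx hx0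

end LeavittPathAlgebra

/-! ### A trace obtained from paths that end at a fixed vertex. -/

namespace Leavitt

variable {V E : Type*} [DecidableEq V] [DecidableEq E] (G : DirectedGraph V E) (o : V)

/-- Lists of edges, seen as paths that end at the vertex `o`. -/
def listModel : PathModel G (List E) where
  start x := x.head?.elim o G.s
  cons := List.cons
  uncons
    | [] => none
    | e :: x => if x.head?.elim o G.s = G.r e then some (e, x) else none
  uncons_cons e x hx := if_pos hx
  start_of_uncons := by
    rintro (_ | ⟨f, y⟩) e x h
    · simp at h
    · simp only [Option.ite_none_right_eq_some, Option.some.injEq, Prod.mk.injEq] at h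
      obtain ⟨h, rfl, rfl⟩ := h
      exact h
  cons_of_uncons := by
    rintro (_ | ⟨f, y⟩) e x h
    · simp at h
    · simp only [Option.ite_none_right_eq_some, Option.some.injEq, Prod.mk.injEq] at h
      obtain ⟨h, rfl, rfl⟩ := h
      rfl
  start_cons e x _ := rfl

omit [DecidableEq E] in
theorem listModel_start_nil : (listModel G o).start [] = o := rfl

omit [DecidableEq E] in
theorem listModel_start_cons (e : E) (x : List E) : (listModel G o).start (e :: x) = G.s e := rfl

omit [DecidableEq E] in
theorem listModel_uncons_cons (e : E) (x : List E) : (listModel G o).uncons (e :: x) =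
    if (listModel G o).start x = G.r e then some (e, x) else none := rfl

variable (K : Type*) [Field K] [Fintype E]

/-- The sum of a function over all paths of length `n` from `v` to `o`. -/
def pathSum : ℕ → V → (List E → K) →ₗ[K] K
  | 0, v => if v = o then LinearMap.proj [] else 0
  | n + 1, v => ∑ e, if G.s e = v then
      (pathSum n (G.r e)).comp (LinearMap.funLeft K K (List.cons e)) else 0

omit [DecidableEq E] in
theorem pathSum_zero (v : V) (c : List E → K) :
    pathSum G o K 0 v c = if v = o then c [] else 0 := by
  rw [pathSum]; split_ifs <;> simp

omit [DecidableEq E] in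
theorem pathSum_succ (n : ℕ) (v : V) (c : List E → K) : pathSum G o K (n + 1) v c =
    ∑ e, if G.s e = v then pathSum G o K n (G.r e) (fun x => c (e :: x)) else 0 := by
  rw [pathSum, LinearMap.sum_apply]
  refine Finset.sum_congr rfl fun e _ => ?_
  split_ifs <;> rfl

omit [DecidableEq E] in
-- Only lists that start at `v` contribute to the sum.
theorem pathSum_ite_start (n : ℕ) (v w : V) (c : List E → K) :
    pathSum G o K n v (fun x => if (listModel G o).start x = w then c x else 0) =
      if v = w then pathSum G o K n v c else 0 := by
  cases n with
  | zero =>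
    simp only [pathSum_zero, listModel_start_nil]
    grind
  | succ n =>
    simp only [pathSum_succ, listModel_start_cons]
    by_cases hvw : v = w
    · rw [if_pos hvw]
      refine Finset.sum_congr rfl fun e _ => ?_
      by_cases he : G.s e = v
      · simp [he, hvw]
      · simp [he]
    · rw [if_neg hvw]
      refine Finset.sum_eq_zero fun e _ => ?_
      by_cases he : G.s e = v
      · rw [if_pos he]
        convert map_zero (pathSum G o K n (G.r e)) using 2
        ext x
        simp [he, hvw]
      · simp [he]

omit [DecidableEq E] in
theorem pathSum_congr (n : ℕ) (v : V) {c d : List E → K}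
    (h : ∀ x, (listModel G o).start x = v → c x = d x) :
    pathSum G o K n v c = pathSum G o K n v d := by
  have h1 := pathSum_ite_start G o K n v v c
  have h2 := pathSum_ite_start G o K n v v d
  rw [if_pos rfl] at h1 h2
  rw [← h1, ← h2]
  congr 1
  ext x
  split_ifs with hx
  · exact h x hx
  · rfl

variable [Fintype V]

/-- The sum of the diagonal entries of an operator over all paths of length `n` that end at `o`. -/
def levelTrace (n : ℕ) : Module.End K (List E → K) →ₗ[K] K where
  toFun b := ∑ v, pathSum G o K n v fun x => b (Pi.single x 1) x
  map_add' a b := by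
    rw [← Finset.sum_add_distrib]
    refine Finset.sum_congr rfl fun v _ => ?_
    rw [← map_add]
    rfl
  map_smul' k b := by
    rw [RingHom.id_apply, Finset.smul_sum]
    refine Finset.sum_congr rfl fun v _ => ?_
    rw [← map_smul]
    rfl

theorem levelTrace_apply (n : ℕ) (b : Module.End K (List E → K)) :
    levelTrace G o K n b = ∑ v, pathSum G o K n v fun x => b (Pi.single x 1) x := rfl

theorem levelTrace_succ (n : ℕ) (b : Module.End K (List E → K)) : levelTrace G o K (n + 1) b =
    ∑ e, pathSum G o K n (G.r e) fun x => b (Pi.single (e :: x) 1) (e :: x) := by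
  simp only [levelTrace_apply, pathSum_succ]
  rw [Finset.sum_comm]
  simp

omit [Fintype E] [Fintype V] in
theorem edgeOp_single (e : E) (x : List E) :
    (listModel G o).edgeOp K e (Pi.single x 1) =
      if (listModel G o).start x = G.r e then Pi.single (e :: x) 1 else 0 := by
  ext y
  rw [PathModel.edgeOp_apply]
  cases y with
  | nil =>
    have : (listModel G o).uncons [] = none := rfl
    rw [this]
    split_ifs <;> simp
  | cons f y =>
    rw [listModel_uncons_cons]
    by_cases hx : (listModel G o).start x = G.r e <;> by_cases hy : (listModel G o).start y = G.r f
    all_goals simp only [hx, hy, if_true, if_false, Option.elim_some, Option.elim_none,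
      Pi.single_apply, List.cons.injEq, Pi.zero_apply]
    all_goals grind

omit [Fintype E] [Fintype V] in
theorem ghostOp_single_cons (e f : E) (x : List E) :
    (listModel G o).ghostOp K e (Pi.single (f :: x) 1) =
      if f = e ∧ (listModel G o).start x = G.r e then Pi.single x 1 else 0 := by
  ext y
  rw [PathModel.ghostOp_apply]
  change (if (listModel G o).start y = G.r e then (Pi.single (f :: x) 1 : List E → K) (e :: y)
    else 0) = _
  rw [apply_ite (fun g : List E → K => g y)]
  simp only [Pi.single_apply, List.cons.injEq, Pi.zero_apply]
  grind

/-- The diagonal entry of `S_e b` at a path `e x` is that of `b S_e` at `x`, and the entries at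
paths with another first edge vanish. Cyclicity thus holds up to a shift of the level. -/
theorem levelTrace_edgeOp_mul (n : ℕ) (e : E) (b : Module.End K (List E → K)) :
    levelTrace G o K (n + 1) ((listModel G o).edgeOp K e * b) =
      levelTrace G o K n (b * (listModel G o).edgeOp K e) := by
  rw [levelTrace_succ, levelTrace_apply]
  have h1 : ∀ f, (pathSum G o K n (G.r f) fun x =>
      ((listModel G o).edgeOp K e * b) (Pi.single (f :: x) 1) (f :: x)) =
      if f = e then pathSum G o K n (G.r e) fun x => b (Pi.single (e :: x) 1) x else 0 := by
    intro f
    split_ifs with hf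
    · subst hf
      refine pathSum_congr G o K n _ fun x hx => ?_
      rw [Module.End.mul_apply, PathModel.edgeOp_apply, listModel_uncons_cons, if_pos hx]
      simp
    · rw [← map_zero (pathSum G o K n (G.r f))]
      congr 1
      ext x
      rw [Module.End.mul_apply, PathModel.edgeOp_apply, listModel_uncons_cons]
      split_ifs <;> simp [hf]
  have h2 : ∀ v, (pathSum G o K n v fun x =>
      (b * (listModel G o).edgeOp K e) (Pi.single x 1) x) =
      if v = G.r e then pathSum G o K n v fun x => b (Pi.single (e :: x) 1) x else 0 := by
    intro v
    rw [← pathSum_ite_start]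
    congr 1
    ext x
    rw [Module.End.mul_apply, edgeOp_single]
    split_ifs <;> simp
  simp only [h1, h2, Finset.sum_ite_eq', Finset.mem_univ, if_true]

theorem levelTrace_mul_ghostOp (n : ℕ) (e : E) (b : Module.End K (List E → K)) :
    levelTrace G o K (n + 1) (b * (listModel G o).ghostOp K e) =
      levelTrace G o K n ((listModel G o).ghostOp K e * b) := by
  rw [levelTrace_succ, levelTrace_apply]
  have h1 : ∀ f, (pathSum G o K n (G.r f) fun x =>
      (b * (listModel G o).ghostOp K e) (Pi.single (f :: x) 1) (f :: x)) =
      if f = e then pathSum G o K n (G.r e) fun x => b (Pi.single x 1) (e :: x) else 0 := by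
    intro f
    split_ifs with hf
    · subst hf
      refine pathSum_congr G o K n _ fun x hx => ?_
      rw [Module.End.mul_apply, ghostOp_single_cons, if_pos ⟨rfl, hx⟩]
    · rw [← map_zero (pathSum G o K n (G.r f))]
      congr 1
      ext x
      rw [Module.End.mul_apply, ghostOp_single_cons, if_neg (fun h => hf h.1)]
      simp
  have h2 : ∀ v, (pathSum G o K n v fun x =>
      ((listModel G o).ghostOp K e * b) (Pi.single x 1) x) =
      if v = G.r e then pathSum G o K n v fun x => b (Pi.single x 1) (e :: x) else 0 := by
    intro v
    rw [← pathSum_ite_start]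
    rfl
  simp only [h1, h2, Finset.sum_ite_eq', Finset.mem_univ, if_true]

theorem levelTrace_vertexOp_mul (n : ℕ) (v : V) (b : Module.End K (List E → K)) :
    levelTrace G o K n ((listModel G o).vertexOp K v * b) =
      levelTrace G o K n (b * (listModel G o).vertexOp K v) := by
  rw [levelTrace_apply, levelTrace_apply]
  refine Finset.sum_congr rfl fun w _ => ?_
  congr 1
  ext x
  have h : (listModel G o).vertexOp K v (Pi.single x 1) =
      if (listModel G o).start x = v then Pi.single x 1 else 0 := by
    ext y
    rw [PathModel.vertexOp_apply]
    by_cases hxy : y = x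
    · subst hxy; split_ifs <;> simp
    · split_ifs <;> simp [hxy]
  rw [Module.End.mul_apply, Module.End.mul_apply, h, PathModel.vertexOp_apply]
  split_ifs <;> simp

omit [DecidableEq E] [Fintype V] in
/-- The number of paths of length `n` from `v` to `o`, as an element of `K`. -/
theorem pathSum_one
    (ho : ∀ v, (∑ e, if G.s e = v then (if G.r e = o then 1 else 0) else 0 : K) =
      if v = o then 1 else 0) (n : ℕ) (v : V) :
    pathSum G o K n v (fun _ => 1) = if v = o then 1 else 0 := by
  induction n generalizing v with
  | zero => rw [pathSum_zero]
  | succ n ih =>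
    rw [pathSum_succ, ← ho v]
    simp only [ih]

theorem levelTrace_vertexOp (n : ℕ) (v : V) : levelTrace G o K n ((listModel G o).vertexOp K v) =
    pathSum G o K n v (fun _ => 1) := by
  rw [levelTrace_apply]
  have h : ∀ w, (pathSum G o K n w fun x =>
      ((listModel G o).vertexOp K v) (Pi.single x 1) x) =
      if w = v then pathSum G o K n w fun _ => 1 else 0 := by
    intro w
    rw [← pathSum_ite_start]
    congr 1
    ext x
    rw [PathModel.vertexOp_apply, Pi.single_eq_same]
  simp only [h, Finset.sum_ite_eq', Finset.mem_univ, if_true]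

/-- The operator raises the length of lists by `k`. -/
def RaisesLength {K E : Type*} [Field K] (k : ℤ) (b : Module.End K (List E → K)) : Prop :=
  ∀ (m : ℤ) (g : List E → K), (∀ x, (x.length : ℤ) = m → g x = 0) →
    ∀ x, (x.length : ℤ) = m + k → b g x = 0

section RaisesLength

omit [Fintype V] [Fintype E]

variable {K}

omit [DecidableEq V] [DecidableEq E] in
theorem RaisesLength.mul {k l : ℤ} {a b : Module.End K (List E → K)} (ha : RaisesLength k a)
    (hb : RaisesLength l b) : RaisesLength (k + l) (a * b) := fun m g hg x hx =>
  ha (m + l) (b g) (hb m g hg) x (by rw [hx]; ring)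

variable (K)

omit [DecidableEq E] in
theorem raisesLength_vertexOp (v : V) : RaisesLength 0 ((listModel G o).vertexOp K v) := by
  intro m g hg x hx
  rw [PathModel.vertexOp_apply, hg x (by simpa using hx), ite_self]

theorem raisesLength_edgeOp (e : E) : RaisesLength 1 ((listModel G o).edgeOp K e) := by
  intro m g hg x hx
  rw [PathModel.edgeOp_apply]
  cases x with
  | nil => rfl
  | cons f x =>
    rw [listModel_uncons_cons]
    have := hg x (by simpa using hx)
    split_ifs <;> simp [this]

omit [DecidableEq E] in
theorem raisesLength_ghostOp (e : E) : RaisesLength (-1) ((listModel G o).ghostOp K e) := by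
  intro m g hg x hx
  rw [PathModel.ghostOp_apply]
  have : g ((listModel G o).cons e x) = 0 := hg (e :: x) (by rw [List.length_cons]; push_cast; omega)
  rw [this, ite_self]

theorem raisesLength_monomial (μ : List E) (v : V) (ν : List E) :
    RaisesLength ((μ.length : ℤ) - ν.length) (monomial ((listModel G o).vertexOp K)
      ((listModel G o).edgeOp K) ((listModel G o).ghostOp K) μ v ν) := by
  have hone : RaisesLength 0 (1 : Module.End K (List E → K)) := fun m g hg x hx =>
    hg x (by simpa using hx)
  have h1 : RaisesLength (μ.length : ℤ) (μ.map ((listModel G o).edgeOp K)).prod := by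
    induction μ with
    | nil => exact hone
    | cons e μ ih =>
      have := (raisesLength_edgeOp G o K e).mul ih
      rw [List.map_cons, List.prod_cons, List.length_cons]
      push_cast
      rwa [add_comm]
  have h2 : RaisesLength (-(ν.length : ℤ)) (ν.map ((listModel G o).ghostOp K)).prod := by
    induction ν with
    | nil => exact hone
    | cons e ν ih =>
      have := (raisesLength_ghostOp G o K e).mul ih
      rw [List.map_cons, List.prod_cons, List.length_cons]
      push_cast
      rwa [neg_add, add_comm]
  have := (h1.mul (raisesLength_vertexOp G o K v)).mul h2
  rwa [add_zero, ← sub_eq_add_neg] at this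

end RaisesLength

/-- An operator that changes the length has zero diagonal entries. -/
theorem levelTrace_eq_zero_of_raisesLength {k : ℤ} (hk : k ≠ 0) {b : Module.End K (List E → K)}
    (hb : RaisesLength k b) (n : ℕ) : levelTrace G o K n b = 0 := by
  rw [levelTrace_apply]
  refine Finset.sum_eq_zero fun v _ => ?_
  convert map_zero (pathSum G o K n v) using 2
  ext x
  refine hb (x.length - k) _ (fun y hy => ?_) x (by ring)
  rw [Pi.single_eq_of_ne]
  rintro rfl
  omega

section Trace

variable (ho : ∀ v, (∑ e, if G.s e = v then (if G.r e = o then 1 else 0) else 0 : K) =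
  if v = o then 1 else 0)

include ho

/-- If the numbers of edges and ghost edges differ, every trace is zero. Otherwise moving the first
edge to the right end cancels a ghost edge at the cost of one level, until zero or a vertex remains;
by `ho`, a vertex has the same trace at every level. -/
theorem exists_levelTrace_monomial_eq (μ : List E) (v : V) (ν : List E) :
    ∃ c : K, ∀ n, μ.length ≤ n → levelTrace G o K n (monomial ((listModel G o).vertexOp K)
      ((listModel G o).edgeOp K) ((listModel G o).ghostOp K) μ v ν) = c := by
  by_cases hd : μ.length = ν.length
  · induction μ generalizing ν with
    | nil =>
      obtain rfl : ν = [] := by simpa using hd.symm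
      refine ⟨if v = o then 1 else 0, fun n _ => ?_⟩
      rw [← pathSum_one G o K ho n v, ← levelTrace_vertexOp]
      simp [monomial]
    | cons e μ ih =>
      rcases List.eq_nil_or_concat ν with rfl | ⟨ν, f, rfl⟩
      · simp at hd
      have hM := (listModel G o).isCohnFamily K
      rw [List.concat_eq_append] at hd ⊢
      have hd' : μ.length = ν.length := by simpa using hd
      obtain ⟨c, hc⟩ : ∃ c : K, ∀ n, μ.length ≤ n → levelTrace G o K n
          (monomial ((listModel G o).vertexOp K) ((listModel G o).edgeOp K)
            ((listModel G o).ghostOp K) μ v (ν ++ [f]) * (listModel G o).edgeOp K e) = c := by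
        rw [hM.monomial_concat_mul_edge]
        split_ifs
        · rcases hM.monomial_mul_vertex (G.r f) μ v ν with h | h <;> rw [h]
          · exact ih ν hd'
          · exact ⟨0, by simp⟩
        · exact ⟨0, by simp⟩
      refine ⟨c, fun n hn => ?_⟩
      rw [List.length_cons] at hn
      obtain ⟨n, rfl⟩ := Nat.exists_eq_succ_of_ne_zero (show n ≠ 0 by omega)
      rw [← IsCohnFamily.edge_mul_monomial, Nat.succ_eq_add_one, levelTrace_edgeOp_mul]
      exact hc n (by omega)
  · exact ⟨0, fun n _ => levelTrace_eq_zero_of_raisesLength G o K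
      (by omega) (raisesLength_monomial G o K μ v ν) n⟩

/-- The action of the free algebra on functions on paths. -/
abbrev pathAction : FreeAlgebra K (Gen V E) →ₐ[K] Module.End K (List E → K) :=
  FreeAlgebra.lift K (familyMap ((listModel G o).vertexOp K) ((listModel G o).edgeOp K)
    ((listModel G o).ghostOp K))

theorem eventually_levelTrace_succ_eq (X : FreeAlgebra K (Gen V E)) :
    ∀ᶠ n in Filter.atTop, levelTrace G o K (n + 1) (pathAction G o K X) =
      levelTrace G o K n (pathAction G o K X) := by
  have hX := ((listModel G o).isCohnFamily K).lift_mem_span_monomial K X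
  change pathAction G o K X ∈ _ at hX
  generalize pathAction G o K X = b at hX
  induction hX using Submodule.span_induction with
  | mem b hb =>
    obtain ⟨μ, v, ν, rfl⟩ := hb
    obtain ⟨c, hc⟩ := exists_levelTrace_monomial_eq G o K ho μ v ν
    filter_upwards [Filter.eventually_ge_atTop μ.length] with n hn
    rw [hc n hn, hc (n + 1) (by omega)]
  | zero => simp
  | add a b _ _ ha hb =>
    filter_upwards [ha, hb] with n ha hb
    rw [map_add, map_add, ha, hb]
  | smul k a _ ha =>
    filter_upwards [ha] with n ha
    rw [map_smul, map_smul, ha]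

/-- For a single edge or ghost edge, the shift of level is absorbed by eventual constancy. Products
follow by cycling one factor at a time. -/
theorem eventually_levelTrace_mul_comm (X Y : FreeAlgebra K (Gen V E)) :
    ∀ᶠ n in Filter.atTop, levelTrace G o K n (pathAction G o K (X * Y)) =
      levelTrace G o K n (pathAction G o K (Y * X)) := by
  induction X using FreeAlgebra.induction generalizing Y with
  | grade0 k => simp [Algebra.commutes]
  | grade1 x =>
    rcases x with v | e | e
    · refine Filter.Eventually.of_forall fun n => ?_
      rw [map_mul (pathAction G o K), map_mul (pathAction G o K),
        FreeAlgebra.lift_ι_apply]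
      exact levelTrace_vertexOp_mul G o K n v _
    · have h1 := eventually_levelTrace_succ_eq G o K ho (FreeAlgebra.ι K (.edge e) * Y)
      filter_upwards [h1] with n h1
      rw [← h1, map_mul (pathAction G o K), map_mul (pathAction G o K),
        FreeAlgebra.lift_ι_apply]
      exact levelTrace_edgeOp_mul G o K n e _
    · have h1 := eventually_levelTrace_succ_eq G o K ho (Y * FreeAlgebra.ι K (.ghost e))
      filter_upwards [h1] with n h1
      rw [← h1, map_mul (pathAction G o K), map_mul (pathAction G o K),
        FreeAlgebra.lift_ι_apply]
      exact (levelTrace_mul_ghostOp G o K n e _).symm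
  | mul a b ha hb =>
    filter_upwards [ha (b * Y), hb (Y * a)] with n ha hb
    rw [mul_assoc, ha, mul_assoc, hb, mul_assoc]
  | add a b ha hb =>
    filter_upwards [ha Y, hb Y] with n ha hb
    rw [add_mul, mul_add, map_add, map_add, map_add, map_add, ha, hb]

/-- Every relation but (CK2) holds exactly for the operators. The failure of (CK2) is invisible at
positive levels once `X` has been moved cyclically to the right end. -/
theorem eventually_levelTrace_eq_of_rel {a b : FreeAlgebra K (Gen V E)} (h : Rel K G a b)
    (X Y : FreeAlgebra K (Gen V E)) :
    ∀ᶠ n in Filter.atTop, levelTrace G o K n (pathAction G o K (X * a * Y)) =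
      levelTrace G o K n (pathAction G o K (X * b * Y)) := by
  have hM := (listModel G o).isCohnFamily K
  have of_eq : pathAction G o K a = pathAction G o K b →
      ∀ᶠ n in Filter.atTop, levelTrace G o K n (pathAction G o K (X * a * Y)) =
        levelTrace G o K n (pathAction G o K (X * b * Y)) := fun h => by
    simp only [map_mul, h, Filter.eventually_true]
  cases h with
  | vertex_mul_self v => exact of_eq (by simp [gen, familyMap, hM.vertex_mul_vertex])
  | vertex_mul_of_ne v w h => exact of_eq (by simp [gen, familyMap, hM.vertex_mul_vertex, h])
  | source_mul_edge e => exact of_eq (by simp [gen, familyMap, hM.vertex_mul_edge])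
  | edge_mul_range e => exact of_eq (by simp [gen, familyMap, hM.edge_mul_vertex])
  | range_mul_ghost e => exact of_eq (by simp [gen, familyMap, hM.vertex_mul_ghost])
  | ghost_mul_source e => exact of_eq (by simp [gen, familyMap, hM.ghost_mul_vertex])
  | ghost_mul_edge_self e => exact of_eq (by simp [gen, familyMap, hM.ghost_mul_edge])
  | ghost_mul_edge_of_ne e f h => exact of_eq (by simp [gen, familyMap, hM.ghost_mul_edge, h])
  | sum_vertex => exact of_eq (by simp [gen, familyMap, hM.sum_vertex])
  | vertex_eq_sum v hv =>
    have key : ∀ n (c : Module.End K (List E → K)), levelTrace G o K (n + 1)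
        ((listModel G o).vertexOp K v * c) = levelTrace G o K (n + 1)
          ((∑ e ∈ hv.1.toFinset, (listModel G o).edgeOp K e * (listModel G o).ghostOp K e) * c) := by
      intro n c
      rw [levelTrace_succ, levelTrace_succ]
      refine Finset.sum_congr rfl fun e _ => pathSum_congr G o K n _ fun x hx => ?_
      rw [Module.End.mul_apply, Module.End.mul_apply]
      refine ((listModel G o).sum_edgeOp_mul_ghostOp_apply K v _ (by simp) _ ?_).symm
      rw [listModel_uncons_cons, if_pos hx]
      simp
    have h1 := eventually_levelTrace_mul_comm G o K ho X (gen K (.vertex v) * Y)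
    have h2 := eventually_levelTrace_mul_comm G o K ho X
      ((∑ e ∈ hv.1.toFinset, gen K (.edge e) * gen K (.ghost e)) * Y)
    filter_upwards [h1, h2, Filter.eventually_ge_atTop 1] with n h1 h2 hn
    obtain ⟨n, rfl⟩ := Nat.exists_eq_succ_of_ne_zero (show n ≠ 0 by omega)
    rw [mul_assoc, h1, mul_assoc X, h2, mul_assoc, mul_assoc, map_mul (pathAction G o K),
      map_mul (pathAction G o K)]
    have := key n (pathAction G o K (Y * X))
    simpa [gen, familyMap] using this

theorem eventually_levelTrace_eq_of_mkAlgHom_eq {a b : FreeAlgebra K (Gen V E)}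
    (h : RingQuot.mkAlgHom K (Rel K G) a = RingQuot.mkAlgHom K (Rel K G) b) :
    ∀ᶠ n in Filter.atTop, levelTrace G o K n (pathAction G o K a) =
      levelTrace G o K n (pathAction G o K b) := by
  -- Arbitrary factors `X` and `Y` on the two sides let the induction pass through the closure of
  -- the relations under multiplication.
  have hrel : ∀ {a b}, RingQuot.Rel (Rel K G) a b → ∀ X Y : FreeAlgebra K (Gen V E),
      ∀ᶠ n in Filter.atTop, levelTrace G o K n (pathAction G o K (X * a * Y)) =
        levelTrace G o K n (pathAction G o K (X * b * Y)) := by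
    intro a b h
    induction h with
    | of h => exact eventually_levelTrace_eq_of_rel G o K ho h
    | add_left _ ih =>
      intro X Y
      filter_upwards [ih X Y] with n ih
      rw [mul_add, add_mul, mul_add, add_mul, map_add, map_add, map_add, map_add, ih]
    | @mul_left a b c _ ih =>
      intro X Y
      simpa only [mul_assoc] using ih X (c * Y)
    | @mul_right a b c _ ih =>
      intro X Y
      simpa only [mul_assoc] using ih (X * a) Y
  have heqv : Relation.EqvGen (RingQuot.Rel (Rel K G)) a b := by
    simp only [RingQuot.mkAlgHom_def, RingQuot.mkRingHom_def, AlgHom.coe_mk, RingHom.coe_mk,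
      MonoidHom.coe_mk, OneHom.coe_mk, RingQuot.mk.injEq] at h
    exact Quot.eqvGen_exact h
  clear h
  induction heqv with
  | rel a b h => simpa using hrel h 1 1
  | refl => simp
  | symm a b _ ih => filter_upwards [ih] with n ih using ih.symm
  | trans a b c _ _ ih ih' => filter_upwards [ih, ih'] with n ih ih' using ih.trans ih'

/-- A vertex `o` such that, in `K`, the number of edges from `v` to `o` is `1` if `v = o` and `0`
otherwise, gives a trace that maps `1` to `1`. -/
theorem one_notMem_commutatorSpan :
    (1 : LeavittPathAlgebra K G) ∉ commutatorSpan K (LeavittPathAlgebra K G) := by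
  let D : Submodule K (FreeAlgebra K (Gen V E)) :=
    { carrier := {X | ∀ᶠ n in Filter.atTop, levelTrace G o K n (pathAction G o K X) = 0}
      add_mem' := fun ha hb => by
        filter_upwards [ha, hb] with n ha hb
        rw [map_add, map_add, ha, hb, add_zero]
      zero_mem' := by simp
      smul_mem' := fun k a ha => by
        filter_upwards [ha] with n ha
        rw [map_smul, map_smul, ha, smul_zero] }
  have hle : commutatorSpan K (LeavittPathAlgebra K G) ≤
      D.map (RingQuot.mkAlgHom K (Rel K G)).toLinearMap := by
    refine Submodule.span_le.2 ?_
    rintro _ ⟨x, y, rfl⟩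
    obtain ⟨X, rfl⟩ := RingQuot.mkAlgHom_surjective K (Rel K G) x
    obtain ⟨Y, rfl⟩ := RingQuot.mkAlgHom_surjective K (Rel K G) y
    refine ⟨X * Y - Y * X, ?_, by simp⟩
    filter_upwards [eventually_levelTrace_mul_comm G o K ho X Y] with n h
    rw [map_sub, map_sub, h, sub_self]
  intro h1
  obtain ⟨X, hX, hX1⟩ := hle h1
  have h2 := eventually_levelTrace_eq_of_mkAlgHom_eq G o K ho (a := X) (b := 1)
    (by rw [map_one]; exact hX1)
  -- At such a level the trace of `1` would be `0`, while the vertices contribute exactly `1`,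
  -- coming from `o`.
  obtain ⟨n, h3, h4⟩ := (Filter.Eventually.and hX h2).exists
  rw [h3, map_one, ← ((listModel G o).isCohnFamily K).sum_vertex, map_sum] at h4
  simp only [levelTrace_vertexOp, pathSum_one G o K ho] at h4
  simp at h4

end Trace

end Leavitt

/-! ### Simplicity of the Lie algebra `[L, L]`. -/

namespace LeavittPathAlgebra

open Leavitt

variable (K : Type*) [Field K] {V E : Type*} [Fintype V] [Fintype E] (G : DirectedGraph V E)

theorem completeOrthogonalIdempotents (hG : ∀ v, ∃ e, G.s e = v) :
    CompleteOrthogonalIdempotents fun e => of K G (.edge e) * of K G (.ghost e) := by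
  classical
  have h := isCohnFamily K G
  refine CompleteOrthogonalIdempotents.iff_ortho_complete.2 ⟨fun e f hef => ?_,
    sum_edge_mul_ghost K G hG⟩
  have h1 := h.ghost_mul_edge e f
  rw [if_neg hef] at h1
  beta_reduce
  rw [mul_assoc, ← mul_assoc (of K G (.ghost e)), h1, zero_mul, mul_zero]

omit [Fintype E] in
-- If `e e* = 0`, then `r(e) = e* (e e*) e = 0`. Every vertex `w` then vanishes as `g* r(e) g` for
-- an edge `g` from `r(e)` to `w`, and so does `1`.
theorem edge_mul_ghost_ne_zero [Nontrivial (LeavittPathAlgebra K G)]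
    (hG : ∀ v w, ∃ e, G.s e = v ∧ G.r e = w) (e : E) :
    of K G (.edge e) * of K G (.ghost e) ≠ 0 := by
  classical
  have h := isCohnFamily K G
  intro h0
  have h1 : of K G (.vertex (G.r e)) = 0 := by
    have h2 := h.ghost_mul_edge e e
    rw [if_pos rfl] at h2
    have h3 := h.vertex_mul_vertex (G.r e) (G.r e)
    rw [if_pos rfl] at h3
    rw [← h3, ← h2, mul_assoc, ← mul_assoc (of K G (.edge e)), h0, zero_mul, mul_zero]
  refine one_ne_zero (α := LeavittPathAlgebra K G) ?_
  rw [← sum_vertex K G]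
  refine Finset.sum_eq_zero fun w _ => ?_
  obtain ⟨g, hs, hr⟩ := hG (G.r e) w
  have h4 := h.ghost_mul_edge g g
  rw [if_pos rfl, hr] at h4
  have h5 := h.vertex_mul_edge (G.r e) g
  rw [if_pos hs.symm, h1, zero_mul] at h5
  rw [← h4, ← h5, mul_zero]

/-- `[L, L]` is a simple Lie algebra if the Leavitt path algebra `L` of a graph in which any two
vertices are joined by two edges has `1 ∉ [L, L]`. -/
theorem isSimple_commutators [Nonempty V] (hcard : 4 ≤ Fintype.card E)
    (hG : ∀ v w, ∃ e f, e ≠ f ∧ G.s e = v ∧ G.s f = v ∧ G.r e = w ∧ G.r f = w)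
    (h1 : (1 : LeavittPathAlgebra K G) ∉ commutatorSpan K (LeavittPathAlgebra K G)) :
    LieAlgebra.IsSimple K (commutators K G) := by
  have hsimple := isSimpleRing K G hG
  have hG1 : ∀ v w, ∃ e, G.s e = v ∧ G.r e = w := fun v w => by
    obtain ⟨e, -, -, hs, -, hr, -⟩ := hG v w
    exact ⟨e, hs, hr⟩
  have he := completeOrthogonalIdempotents K G fun v => (hG1 v v).imp fun _ h => h.1
  have hne := edge_mul_ghost_ne_zero K G hG1
  have hmem : ∀ x, x ∈ commutators K G ↔ x ∈ commutatorSpan K (LeavittPathAlgebra K G) := 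
    fun x => SetLike.ext_iff.1 (commutators_eq_span K G) x
  refine ⟨fun I => ?_, fun hab => ?_⟩
  · let U : Submodule K (LeavittPathAlgebra K G) :=
      I.toSubmodule.map (commutators K G).toSubmodule.subtype
    have hU : ∀ u ∈ U, ∀ s ∈ commutatorSpan K (LeavittPathAlgebra K G), s * u - u * s ∈ U := by
      rintro _ ⟨u, hu, rfl⟩ s hs
      exact ⟨⁅(⟨s, (hmem s).2 hs⟩ : commutators K G), u⁆, I.lie_mem hu, rfl⟩
    rcases CompleteOrthogonalIdempotents.central_or_commutatorSpan_le he hne hU hcard with h | h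
    · refine Or.inl ((LieSubmodule.eq_bot_iff I).2 fun u hu => Subtype.ext ?_)
      exact IsSimpleRing.eq_zero_of_mem_commutatorSpan_of_central h1 ((hmem _).1 u.2)
        (h u ⟨u, hu, rfl⟩)
    · refine Or.inr (eq_top_iff.2 fun u _ => ?_)
      obtain ⟨u', hu', h'⟩ := h ((hmem _).1 u.2)
      rwa [← (Subtype.ext h' : u' = u)]
  -- Not abelian: primeness gives `p_i a p_j b p_i ≠ 0`, and this is `p_i` times the commutator of
  -- `p_i a p_j` and `p_j b p_i`.
  · obtain ⟨i, j, hij⟩ := Fintype.exists_pair_of_one_lt_card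
      (show 1 < Fintype.card E by omega)
    set p := fun e => of K G (.edge e) * of K G (.ghost e) with hp
    obtain ⟨a, ha⟩ := IsSimpleRing.exists_mul_mul_ne_zero (hne i) (hne j)
    obtain ⟨b, hb⟩ := IsSimpleRing.exists_mul_mul_ne_zero ha (hne i)
    change p i * a * p j * b * p i ≠ 0 at hb
    let x : commutators K G := ⟨p i * a * p j, (hmem _).2 (he.offDiag_mem_commutatorSpan hij a)⟩
    let y : commutators K G :=
      ⟨p j * b * p i, (hmem _).2 (he.offDiag_mem_commutatorSpan hij.symm b)⟩
    have hxy : p i * a * p j * (p j * b * p i) - p j * b * p i * (p i * a * p j) = 0 :=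
      congrArg Subtype.val (hab.trivial x y)
    apply hb
    have h2 : p i * _ = p i * 0 := congrArg (p i * ·) hxy
    have h3 : p i * (p i * a * p j * (p j * b * p i) - p j * b * p i * (p i * a * p j)) =
        (p i * p i) * a * (p j * p j) * b * p i - (p i * p j) * b * p i * (p i * a * p j) := by
      rw [mul_sub]
      simp only [mul_assoc]
    have hij' : p i * p j = 0 := he.ortho hij
    rw [h3, (he.idem i).eq, (he.idem j).eq, hij'] at h2
    simpa using h2

end LeavittPathAlgebra

/-! ### The two-vertex graph. -/

theorem twoVertexGraph_exists_two_edges {u v p : ℕ} (hp : p.Prime) (hu : 2 ≤ u) (hv : 2 ≤ v)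
    (a b : Fin 2) : ∃ e f, e ≠ f ∧ (twoVertexGraph u v p).s e = a ∧ (twoVertexGraph u v p).s f = a ∧
      (twoVertexGraph u v p).r e = b ∧ (twoVertexGraph u v p).r f = b := by
  have hp2 := hp.two_le
  have h1 : 2 ≤ p * u := le_trans hu (Nat.le_mul_of_pos_left u hp.pos)
  have h2 : 2 ≤ p * u * v := le_trans h1 (Nat.le_mul_of_pos_right _ (by omega))
  fin_cases a <;> fin_cases b
  · exact ⟨.inl ⟨0, by omega⟩, .inl ⟨1, by omega⟩, by simp, rfl, rfl, rfl, rfl⟩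
  · exact ⟨.inr (.inl ⟨0, by omega⟩), .inr (.inl ⟨1, by omega⟩), by simp, rfl, rfl, rfl, rfl⟩
  · exact ⟨.inr (.inr (.inl ⟨0, by omega⟩)), .inr (.inr (.inl ⟨1, by omega⟩)), by simp,
      rfl, rfl, rfl, rfl⟩
  · exact ⟨.inr (.inr (.inr ⟨0, by omega⟩)), .inr (.inr (.inr ⟨1, by omega⟩)), by simp,
      rfl, rfl, rfl, rfl⟩

/-- The edge counts into `v₁` are `p u v + 1` and `p u`, which reduce to `1` and `0` in
characteristic `p`. -/
theorem twoVertexGraph_card_edges_to_zero (u v p : ℕ) (K : Type*) [Field K] [CharP K p]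
    (a : Fin 2) : (∑ e, if (twoVertexGraph u v p).s e = a then
      (if (twoVertexGraph u v p).r e = 0 then 1 else 0) else 0 : K) = if a = 0 then 1 else 0 := by
  fin_cases a <;> simp [Fintype.sum_sum_type, twoVertexGraph]

theorem mainTheorem10 (p u v : ℕ) (hp : p.Prime) (hu : 2 ≤ u) (hv : 2 ≤ v)
    (K : Type*) [Field K] :
    IsSimpleRing (LeavittPathAlgebra K (twoVertexGraph u v p)) ∧
      (CharP K p →
        LieAlgebra.IsSimple K (LeavittPathAlgebra.commutators K (twoVertexGraph u v p))) := by
  have hG := twoVertexGraph_exists_two_edges (u := u) (v := v) hp hu hv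
  refine ⟨LeavittPathAlgebra.isSimpleRing K _ hG, fun _ => ?_⟩
  refine LeavittPathAlgebra.isSimple_commutators K _ ?_ hG
    (Leavitt.one_notMem_commutatorSpan _ 0 K (twoVertexGraph_card_edges_to_zero u v p K))
  have : 2 ≤ p * u := le_trans hu (Nat.le_mul_of_pos_left u hp.pos)
  simp only [Fintype.card_sum, Fintype.card_fin]
  omega
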